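/- **Setting.** Let $\mathcal S,\mathcal A$ be finite state and action sets ($\mathcal A\neq\emptyset$), $p(s'\mid s,a)$ transition probabilities, $\gamma\in(0,1)$ a discount rate and $\rho$ an initial state distribution. For a reward $r:\mathcal S\times\mathcal A\to\mathbb R$ and a policy $\pi:\mathcal S\to\mathcal A$ let $V^\pi_r(s)=\sum_{t\ge 0}\gamma^t\,\mathbb E[r(s_t,\pi(s_t))\mid s_0=s]$, $V^*_r(s)=\max_\pi V^\pi_r(s)$, $Q^*_r(s,a)=r(s,a)+\gamma\sum_{s'}p(s'\mid s,a)V^*_r(s')$, and let $R^\pi_r=\mathbb E_{s_0\sim\rho}[V^*_r(s_0)-V^\pi_r(s_0)]$ be the regret. The reward is unknown, with a prior probability distribution on $\mathbb R^{\mathcal S\times\mathcal A}$. Let $\beta>0$. Queried at a state $s_0$, the expert produces a trajectory $((s_0,a_0),\dots,(s_m,a_m))$ with $a_t\sim\pi^E_r(\cdot\mid s_t)$, $\pi^E_r(a\mid s)=e^{\beta Q^*_r(s,a)}/\sum_{a'}e^{\beta Q^*_r(s,a')}$, and $s_{t+1}\sim p(\cdot\mid s_t,a_t)$; the $i$-th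 demonstration has a prescribed length $m=m_i\ge 0$ ($m_i=0$ for all $i$ being the case of single-state queries). $\mathcal D_n$ denotes the first $n$ demonstrations and $\mathbb P[\,\cdot\mid\mathcal D_n]$ the Bayesian posterior over $r$. Let $\epsilon>0$ and $\delta\in(0,\tfrac12]$. For a policy $\pi$ put $R^*_{\pi,r}(s,a)=\max\{0,Q^*_r(s,a)-Q^*_r(s,\pi(s))\}$, and let $E^\pi_{s,a}$ be the ternary variable which is "correct" if $R^*_{\pi,r}(s,a)=0$, "approximately correct" if $0<R^*_{\pi,r}(s,a)<\epsilon(1-\gamma)$, and "not correct" if $R^*_{\pi,r}(s,a)\ge\epsilon(1-\gamma)$. Let $E^\pi=(E^\pi_{s,a})_{s,a}$ and let $E=(E^\pi)_\pi$ be the aggregate over all policies $\pi:\mathcal S\to\mathcal A$. *PAC-EIG* works as follows. Given $\mathcal D_n$, the apprentice policy is some $\pi^A_n$ with $\pi^A_n(s)\in\operatorname{argmax}_a\mathbb P[V^*_r(s)-Q^*_r(s,a)=0\mid\mathcal D_n]$ for every $s$, and the next query is a state $s_0$ that maximizes the mutual information (in nats) $I(\tau;E^{\pi^A_n}\mid s_0,\mathcal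 D_n)$ between the demonstration $\tau$ from $s_0$ and $E^{\pi^A_n}$ under the posterior (ties are broken arbitrarily, as a function of $\mathcal D_n$). The *$(\epsilon,\delta)$-PAC condition* holds at step $n$ if there is a policy $\pi$ with $\mathbb P[R^\pi_r\ge\epsilon\mid\mathcal D_n]\le\delta$. Let $N$ be the number of queries made until the PAC condition first holds. **Theorem.** Let $h_{\max}$ be an upper bound on the Shannon entropy (in nats) of $E$ under the prior. If $r$ is drawn from the prior and the demonstrations are collected by PAC-EIG, then $$\mathbb E[N]\;\le\;\frac{h_{\max}}{\mathrm{EIG}_{\min}(\epsilon,\delta)}=\frac{4\,h_{\max}\,|\mathcal A|^2(|\mathcal A|-1)^3|\mathcal S|}{\delta\,(1-e^{-\beta(1-\gamma)\epsilon})^2},\qquad \mathrm{EIG}_{\min}(\epsilon,\delta)=\frac{\delta\,(1-e^{-\beta(1-\gamma)\epsilon})^2}{4|\mathcal A|^2(|\mathcal A|-1)^3|\mathcal S|}$$ (for $|\mathcal A|=1$, where $\mathrm{EIG}_{\min}$ is undefined, the bound is read as $0$). -/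

import Mathlib

open MeasureTheory
open scoped ENNReal

noncomputable section

namespace PACEIG

/-- A finite Markov decision process without its reward: transition probabilities, discount rate
in `(0,1)` and initial state distribution. -/
structure MDP (S A : Type*) [Fintype S] where
  /-- `trans s a s'` is the probability of moving to `s'` when `a` is played in `s`. -/
  trans : S → A → S → ℝ
  trans_nonneg : ∀ s a s', 0 ≤ trans s a s'
  trans_sum : ∀ s a, ∑ s', trans s a s' = 1
  disc : ℝ
  disc_pos : 0 < disc
  disc_lt_one : disc < 1
  init : S → ℝ
  init_nonneg : ∀ s, 0 ≤ init s
  init_sum : ∑ s, init s = 1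

/-- (Expected) reward functions, i.e. vectors indexed by state-action pairs. -/
abbrev Reward (S A : Type*) := S → A → ℝ

section Values

variable {S A : Type*} [Fintype S]

/-- One-step expectation under the policy `π`: `(step π f) s = E[f(s₁) | s₀ = s]`. -/
def step (M : MDP S A) (π : S → A) (f : S → ℝ) : S → ℝ :=
  fun s => ∑ s', M.trans s (π s) s' * f s'

/-- `V^π_r(s) = ∑ₜ γᵗ E[r(sₜ, π(sₜ)) | s₀ = s]`. -/
def value (M : MDP S A) (r : Reward S A) (π : S → A) (s : S) : ℝ :=
  ∑' t : ℕ, M.disc ^ t * (step M π)^[t] (fun x => r x (π x)) s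

/-- `V^*_r(s)`, the best value over (deterministic, stationary) policies. -/
def optValue (M : MDP S A) (r : Reward S A) (s : S) : ℝ :=
  ⨆ π : S → A, value M r π s

/-- `Q^*_r(s,a)`. -/
def optQ (M : MDP S A) (r : Reward S A) (s : S) (a : A) : ℝ :=
  r s a + M.disc * ∑ s', M.trans s a s' * optValue M r s'

/-- The regret `R^π_r = E_{s₀ ∼ ρ}[V^*_r(s₀) - V^π_r(s₀)]`. -/
def regret (M : MDP S A) (r : Reward S A) (π : S → A) : ℝ :=
  ∑ s, M.init s * (optValue M r s - value M r π s)

/-- Immediate regret of `π` in state `s` relative to the action `a`. -/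
def immRegret (M : MDP S A) (r : Reward S A) (π : S → A) (s : S) (a : A) : ℝ :=
  max 0 (optQ M r s a - optQ M r s (π s))

end Values

/-- The three values of the discretized immediate regret. -/
inductive Correctness
  | correct
  | approx
  | incorrect
  deriving DecidableEq

instance : Fintype Correctness where
  elems := {.correct, .approx, .incorrect}
  complete := by intro x; cases x <;> simp

section Regret

variable {S A : Type*} [Fintype S]

/-- `E^π_{s,a}` as a function of the reward. -/
def discRegret (M : MDP S A) (ε : ℝ) (r : Reward S A) (π : S → A) (s : S) (a : A) :
    Correctness :=
  if immRegret M r π s a = 0 then .correct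
  else if immRegret M r π s a < ε * (1 - M.disc) then .approx
  else .incorrect

/-- The variable `E`: all `E^π`, aggregated over all policies `π`. -/
def aggRegret (M : MDP S A) (ε : ℝ) (r : Reward S A) : (S → A) → S → A → Correctness :=
  fun π => discRegret M ε r π

variable [DecidableEq S] [Fintype A] [DecidableEq A]

/-- Shannon entropy (in nats) of `E` under a distribution over rewards. -/
def entropyE (M : MDP S A) (ε : ℝ) (μ : Measure (Reward S A)) : ℝ :=
  ∑ e : (S → A) → S → A → Correctness, Real.negMulLog (μ.real {r | aggRegret M ε r = e})

end Regret

section Expert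

variable {S A : Type*} [Fintype S] [Fintype A]

/-- Boltzmann-rational expert: probability of the action `a` in the state `s`. -/
def expert (M : MDP S A) (β : ℝ) (r : Reward S A) (s : S) (a : A) : ℝ :=
  Real.exp (β * optQ M r s a) / ∑ a', Real.exp (β * optQ M r s a')

/-- Trajectories `((s₀,a₀),…,(s_m,a_m))`. -/
abbrev Traj (S A : Type*) (m : ℕ) := Fin (m + 1) → S × A

/-- Probability that the expert with reward `r` produces the trajectory `t`, given that the
demonstration starts in the initial state of `t`. -/
def trajLik (M : MDP S A) (β : ℝ) (r : Reward S A) {m : ℕ} (t : Traj S A m) : ℝ :=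
  (∏ j, expert M β r (t j).1 (t j).2) *
    ∏ j : Fin m, M.trans (t j.castSucc).1 (t j.castSucc).2 (t j.succ).1

/-- Probability that the expert with reward `r`, queried at `s₀`, produces `t`. -/
def demoProb [DecidableEq S] (M : MDP S A) (β : ℝ) (r : Reward S A) (s₀ : S) {m : ℕ}
    (t : Traj S A m) : ℝ :=
  if (t 0).1 = s₀ then trajLik M β r t else 0

/-- The data `D_n`: the first `n` demonstrations, the `i`-th one having `len i + 1` state-action
pairs. The queried states are the initial states of the demonstrations. -/
abbrev Data (S A : Type*) (len : ℕ → ℕ) (n : ℕ) := (i : Fin n) → Traj S A (len i)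

/-- Likelihood of the data under the reward `r`. -/
def dataLik (M : MDP S A) (β : ℝ) {len : ℕ → ℕ} {n : ℕ} (D : Data S A len n)
    (r : Reward S A) : ℝ :=
  ∏ i, trajLik M β r (D i)

/-- The posterior `p(r | D)`, by Bayes' rule. -/
def posterior (M : MDP S A) (β : ℝ) (prior : Measure (Reward S A)) {len : ℕ → ℕ} {n : ℕ}
    (D : Data S A len n) : Measure (Reward S A) :=
  (∫⁻ r, ENNReal.ofReal (dataLik M β D r) ∂prior)⁻¹ •
    prior.withDensity (fun r => ENNReal.ofReal (dataLik M β D r))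

/-- The PAC condition given the data `D`: some policy has regret at least `ε` with posterior
probability at most `δ`. -/
def PACReached (M : MDP S A) (β ε δ : ℝ) (prior : Measure (Reward S A)) {len : ℕ → ℕ} {n : ℕ}
    (D : Data S A len n) : Prop :=
  ∃ π : S → A, posterior M β prior D {r | ε ≤ regret M r π} ≤ ENNReal.ofReal δ

end Expert

/-- Mutual information (in nats) of two finite random variables with joint probabilities `p`. -/
def mutualInfo {X Y : Type*} [Fintype X] [Fintype Y] (p : X → Y → ℝ) : ℝ :=
  ∑ x, ∑ y, p x y * Real.log (p x y / ((∑ y', p x y') * ∑ x', p x' y))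

section Algorithm

variable {S A : Type*} [Fintype S] [DecidableEq S] [Fintype A] [DecidableEq A]

/-- The acquisition function `I(τ; E^π | s₀, D)`, where `τ` is the next demonstration (with
`len n + 1` state-action pairs), from the query `s₀`. -/
def acquisition (M : MDP S A) (β ε : ℝ) (prior : Measure (Reward S A)) {len : ℕ → ℕ} {n : ℕ}
    (D : Data S A len n) (π : S → A) (s₀ : S) : ℝ :=
  mutualInfo (fun (t : Traj S A (len n)) (e : S → A → Correctness) =>
    ∫ r in {r | discRegret M ε r π = e}, demoProb M β r s₀ t ∂(posterior M β prior D))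

/-- `apprentice` and `query` are choices of the PAC-EIG algorithm (ties broken arbitrarily): in each
state the apprentice policy maximizes the posterior probability of playing an optimal action, and
the query maximizes the acquisition function for this apprentice policy. -/
structure IsPACEIG (M : MDP S A) (β ε : ℝ) (prior : Measure (Reward S A)) (len : ℕ → ℕ)
    (apprentice : (n : ℕ) → Data S A len n → S → A)
    (query : (n : ℕ) → Data S A len n → S) : Prop where
  apprentice_max : ∀ (n : ℕ) (D : Data S A len n) (s : S) (a : A),
    posterior M β prior D {r | optValue M r s - optQ M r s a = 0} ≤
      posterior M β prior D {r | optValue M r s - optQ M r s (apprentice n D s) = 0}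
  query_max : ∀ (n : ℕ) (D : Data S A len n) (s : S),
    acquisition M β ε prior D (apprentice n D) s ≤
      acquisition M β ε prior D (apprentice n D) (query n D)

/-- The data collected up to time `n` along the demonstrations `τ 0, τ 1, …`. -/
def dataAt {Ω : Type*} {len : ℕ → ℕ} (τ : (n : ℕ) → Ω → Traj S A (len n)) (n : ℕ) (ω : Ω) :
    Data S A len n :=
  fun i => τ i ω

/-- `R` is a random reward drawn from the prior and `τ 0, τ 1, …` are the expert's demonstrations
when the `n`-th query is chosen from the data by `query`: given the reward and the first `n`
demonstrations `D`, the next one is distributed as the expert's trajectory from `query n D`. -/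
structure IsRun (M : MDP S A) (β : ℝ) (prior : Measure (Reward S A)) (len : ℕ → ℕ)
    (query : (n : ℕ) → Data S A len n → S) {Ω : Type*} [MeasurableSpace Ω] (ℙ : Measure Ω)
    (R : Ω → Reward S A) (τ : (n : ℕ) → Ω → Traj S A (len n)) : Prop where
  measurable_reward : Measurable R
  map_reward : ℙ.map R = prior
  measurable_demo : ∀ (n : ℕ) (t : Traj S A (len n)), MeasurableSet {ω | τ n ω = t}
  demo_law : ∀ (n : ℕ) (D : Data S A len n) (t : Traj S A (len n)) (B : Set (Reward S A)),
    MeasurableSet B →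
      ℙ {ω | R ω ∈ B ∧ dataAt τ n ω = D ∧ τ n ω = t} =
        ∫⁻ ω in {ω | R ω ∈ B ∧ dataAt τ n ω = D},
          ENNReal.ofReal (demoProb M β (R ω) (query n D) t) ∂ℙ

/-- The number of queries until the PAC condition first holds (`∞` if it never does). -/
def stepsToPAC (M : MDP S A) (β ε δ : ℝ) (prior : Measure (Reward S A)) {len : ℕ → ℕ}
    {Ω : Type*} (τ : (n : ℕ) → Ω → Traj S A (len n)) (ω : Ω) : ℝ≥0∞ :=
  ⨅ (n : ℕ) (_ : PACReached M β ε δ prior (dataAt τ n ω)), (n : ℝ≥0∞)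

/-- `EIG_min(ε, δ)`. -/
def eigMin (M : MDP S A) (β ε δ : ℝ) : ℝ :=
  δ * (1 - Real.exp (-(β * (1 - M.disc) * ε))) ^ 2 /
    (4 * (Fintype.card A : ℝ) ^ 2 * ((Fintype.card A : ℝ) - 1) ^ 3 * (Fintype.card S : ℝ))

end Algorithm

end PACEIG

end

noncomputable section

namespace PACEIG

/-! The entropy of `E` is an information budget, and every query made while the PAC condition fails
spends at least `eigMin` of it in expectation. Write `H n` for the entropy of `E` given the first
`n` demonstrations (`condEntropy`). It starts at the prior entropy of `E`, never becomes negative,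
and `H n - H (n + 1)` is the expected conditional mutual information between the next demonstration
and `E` (`condEntropy_sub`). If this drop is at least `eigMin * ℙ(PAC fails at n)` for every `n`
(`eigMin_mul_le`), telescoping bounds `∑ ℙ(PAC fails at n)` by `hmax / eigMin`, and this sum
dominates the expectation of `N`. `E` collects all policies because the apprentice changes with the
data while the budget must concern one fixed variable. Once the data is given, the apprentice is
fixed and its component is a function of `E`, so data processing (`mutualInfo_fiber_le`) makes the
acquisition value a lower bound for the information gained about `E`. The quantitative step is
`exists_eigMin_le_mutualInfo`. When PAC fails, the apprentice has regret at least `ε` with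
probability above `δ`. Large regret forces a gap of at least `ε (1 - γ)` in some state, so some `s`
is incorrect with probability at least `δ / |S|`. Pigeonholing over actions yields an action `a` and
a set of regret patterns of mass at least `κ = δ / (|S| (|A| - 1))` on which the expert prefers `a`
to the apprentice's action by at least `d = (1 - e^(-β(1-γ)ε)) / (|A| (|A| - 1))` on average. By its
choice rule the apprentice is also optimal in `s` with probability at least `1 / |A| ≥ κ`, and there
the expert does not prefer `a`. The first action of the demonstration thus separates two events of
substantial mass, and `le_mutualInfo`, a variational bound combined with Hoeffding's lemma, gives
information `κ d² / 4 = eigMin`. -/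

lemma nonempty_state {S A : Type*} [Fintype S] (M : MDP S A) : Nonempty S := by
  by_contra hS
  have : IsEmpty S := not_nonempty_iff.1 hS
  simpa using M.init_sum

/-! ### Bellman equations, optimal policies and the regret decomposition -/

section Bellman

variable {S A : Type*} [Fintype S] (M : MDP S A)

lemma step_sub (π : S → A) (f g : S → ℝ) (s : S) :
    step M π (fun x => f x - g x) s = step M π f s - step M π g s := by
  simp [step, mul_sub, Finset.sum_sub_distrib]

lemma step_le_of_le (π : S → A) {f : S → ℝ} {c : ℝ} (h : ∀ s, f s ≤ c) (s : S) :
    step M π f s ≤ c := by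
  calc step M π f s ≤ ∑ s', M.trans s (π s) s' * c :=
        Finset.sum_le_sum fun s' _ => mul_le_mul_of_nonneg_left (h s') (M.trans_nonneg _ _ _)
    _ = c := by rw [← Finset.sum_mul, M.trans_sum, one_mul]

lemma abs_step_le (π : S → A) {f : S → ℝ} {c : ℝ} (h : ∀ s, |f s| ≤ c) (s : S) :
    |step M π f s| ≤ c := by
  rw [abs_le]
  constructor
  · have := step_le_of_le M π (f := fun x => -f x) (c := c)
      (fun s => (neg_le_abs _).trans (h s)) s
    simp only [step, mul_neg, Finset.sum_neg_distrib] at this ⊢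
    linarith
  · exact step_le_of_le M π (fun s => (le_abs_self _).trans (h s)) s

lemma abs_iterate_step_le (π : S → A) {f : S → ℝ} {c : ℝ} (h : ∀ s, |f s| ≤ c) (t : ℕ) (s : S) :
    |(step M π)^[t] f s| ≤ c := by
  induction t generalizing s with
  | zero => exact h s
  | succ t ih =>
    rw [Function.iterate_succ_apply']
    exact abs_step_le M π ih s

lemma summable_value (r : Reward S A) (π : S → A) (s : S) :
    Summable fun t : ℕ => M.disc ^ t * (step M π)^[t] (fun x => r x (π x)) s := by
  obtain ⟨c, hc⟩ : ∃ c : ℝ, ∀ x, |r x (π x)| ≤ c :=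
    ⟨∑ x, |r x (π x)|, fun x =>
      Finset.single_le_sum (f := fun x => |r x (π x)|) (fun _ _ => abs_nonneg _)
        (Finset.mem_univ x)⟩
  refine Summable.of_norm_bounded (g := fun t : ℕ => M.disc ^ t * c)
    ((summable_geometric_of_lt_one M.disc_pos.le M.disc_lt_one).mul_right c) fun t => ?_
  rw [Real.norm_eq_abs, abs_mul, abs_of_nonneg (pow_nonneg M.disc_pos.le t)]
  exact mul_le_mul_of_nonneg_left (abs_iterate_step_le M π hc t s) (pow_nonneg M.disc_pos.le t)

/-- The Bellman equation for a fixed policy. -/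
lemma value_eq (r : Reward S A) (π : S → A) (s : S) :
    value M r π s = r s (π s) + M.disc * step M π (value M r π) s := by
  have h1 : step M π (value M r π) s =
      ∑' t : ℕ, M.disc ^ t * (step M π)^[t + 1] (fun x => r x (π x)) s := by
    simp only [step, value, ← tsum_mul_left]
    rw [← Summable.tsum_finsetSum fun s' _ => (summable_value M r π s').mul_left _]
    congr 1
    funext t
    rw [Function.iterate_succ_apply', step, Finset.mul_sum]
    exact Finset.sum_congr rfl fun _ _ => by ring
  rw [h1, value, (summable_value M r π s).tsum_eq_zero_add, ← tsum_mul_left]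
  simp only [pow_zero, Function.iterate_zero, id_eq, one_mul, pow_succ']
  congr 2
  funext t
  ring

/-- Comparison principle for the discounted evolution under a policy. -/
lemma le_div_of_le_step (π : S → A) {f : S → ℝ} {c : ℝ}
    (h : ∀ s, f s ≤ c + M.disc * step M π f s) (s : S) : f s ≤ c / (1 - M.disc) := by
  have hγ : 0 < 1 - M.disc := sub_pos.2 M.disc_lt_one
  -- At a maximizer of `f` the averaged term is at most the maximum itself, so the inequality closes
  -- up and no iteration is needed.
  obtain ⟨s₀, -, hs₀⟩ := Finset.exists_max_image Finset.univ f ⟨s, Finset.mem_univ s⟩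
  have h1 : f s₀ ≤ c + M.disc * f s₀ := (h s₀).trans <| by
    have := step_le_of_le M π (fun x => hs₀ x (Finset.mem_univ x)) s₀
    have := mul_le_mul_of_nonneg_left this M.disc_pos.le
    linarith
  refine (hs₀ s (Finset.mem_univ s)).trans ?_
  rw [le_div_iff₀ hγ]
  linarith

lemma nonpos_of_le_step (π : S → A) {f : S → ℝ}
    (h : ∀ s, f s ≤ M.disc * step M π f s) (s : S) : f s ≤ 0 := by
  simpa using le_div_of_le_step M π (c := 0) (fun s => by simpa using h s) s

/-- Subtracting the Bellman equation of `π` shows that the loss in value is a one-step loss of at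
most `c` plus the discounted average of later losses; the comparison principle then sums the
geometric series. -/
lemma optValue_sub_value_le (r : Reward S A) (π : S → A) {c : ℝ}
    (h : ∀ s, optValue M r s - optQ M r s (π s) ≤ c) (s : S) :
    optValue M r s - value M r π s ≤ c / (1 - M.disc) := by
  refine le_div_of_le_step M π (f := fun s => optValue M r s - value M r π s) (fun s => ?_) s
  have h1 := h s
  have h2 : optQ M r s (π s) = r s (π s) + M.disc * step M π (optValue M r) s := rfl
  rw [step_sub, value_eq M r π s]
  linarith

/-- A large regret comes from a large loss of optimality in some state. -/
lemma exists_of_le_regret (r : Reward S A) (π : S → A) {ε : ℝ} (h : ε ≤ regret M r π) :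
    ∃ s, ε * (1 - M.disc) ≤ optValue M r s - optQ M r s (π s) := by
  have hγ : 0 < 1 - M.disc := sub_pos.2 M.disc_lt_one
  have hS : Nonempty S := nonempty_state M
  obtain ⟨s, -, hs⟩ := Finset.exists_max_image (Finset.univ : Finset S)
    (fun s => optValue M r s - optQ M r s (π s)) Finset.univ_nonempty
  refine ⟨s, ?_⟩
  rw [← le_div_iff₀ hγ]
  refine h.trans ?_
  calc regret M r π
      ≤ ∑ x, M.init x * ((optValue M r s - optQ M r s (π s)) / (1 - M.disc)) :=
        Finset.sum_le_sum fun x _ => mul_le_mul_of_nonneg_left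
          (optValue_sub_value_le M r π (fun x => hs x (Finset.mem_univ x)) x) (M.init_nonneg x)
    _ = _ := by rw [← Finset.sum_mul, M.init_sum, one_mul]

variable [Fintype A]

lemma value_le_optValue (r : Reward S A) (π : S → A) (s : S) :
    value M r π s ≤ optValue M r s := by
  classical
  exact le_ciSup (f := fun π => value M r π s) (Set.finite_range _).bddAbove π

variable [Nonempty A]

/-- Some policy attains the optimal value in all states, and the optimal value satisfies the
Bellman optimality equation. -/
lemma exists_optimal (r : Reward S A) :
    ∃ π : S → A, (∀ s, optValue M r s = value M r π s) ∧
      (∀ s a, optQ M r s a ≤ optValue M r s) ∧ ∀ s, optQ M r s (π s) = optValue M r s := by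
  classical
  -- Maximizing the sum over all states picks one policy; the greedy policy `π'` is at least as good
  -- in every state, so by maximality it is no better in any. This is policy improvement at a fixed
  -- point.
  obtain ⟨π, -, hπ⟩ := Finset.exists_max_image (Finset.univ : Finset (S → A))
    (fun π => ∑ s, value M r π s) Finset.univ_nonempty
  let q : S → A → ℝ := fun s a => r s a + M.disc * ∑ s', M.trans s a s' * value M r π s'
  have hg : ∀ s, ∃ a, ∀ a', q s a' ≤ q s a := fun s => by
    obtain ⟨a, -, ha⟩ := Finset.exists_max_image (Finset.univ : Finset A) (q s)
      Finset.univ_nonempty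
    exact ⟨a, fun a' => ha a' (Finset.mem_univ _)⟩
  choose π' hπ' using hg
  have hq : ∀ s, value M r π s = q s (π s) := fun s => value_eq M r π s
  have himp : ∀ s, value M r π s ≤ value M r π' s := fun s => by
    have := nonpos_of_le_step M π' (f := fun s => value M r π s - value M r π' s) (fun s => by
      have h1 : value M r π s ≤ r s (π' s) + M.disc * step M π' (value M r π) s :=
        (hq s).le.trans (hπ' s (π s))
      rw [step_sub, value_eq M r π' s]
      linarith) s
    linarith
  have heq : ∀ s, value M r π s = value M r π' s := fun s =>
    (Finset.sum_eq_sum_iff_of_le fun s _ => himp s).1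
      (le_antisymm (Finset.sum_le_sum fun s _ => himp s) (hπ π' (Finset.mem_univ _)))
      s (Finset.mem_univ s)
  have hmax : ∀ s a, q s a ≤ value M r π s := fun s a => by
    refine (hπ' s a).trans ?_
    rw [heq s, value_eq M r π' s]
    have : value M r π = value M r π' := funext heq
    simp only [q, step, this, le_refl]
  have hopt : ∀ s, optValue M r s = value M r π s := fun s => by
    refine le_antisymm (ciSup_le fun π'' => ?_) (value_le_optValue M r π s)
    have := nonpos_of_le_step M π'' (f := fun s => value M r π'' s - value M r π s) (fun s => by
      have h1 : r s (π'' s) + M.disc * step M π'' (value M r π) s ≤ value M r π s :=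
        hmax s (π'' s)
      rw [step_sub, value_eq M r π'' s]
      linarith) s
    linarith
  have hQ : ∀ s a, optQ M r s a = q s a := fun s a => by simp only [optQ, q, hopt]
  exact ⟨π, hopt, fun s a => by rw [hQ, hopt]; exact hmax s a, fun s => by rw [hQ, hopt, hq]⟩

lemma optQ_le_optValue (r : Reward S A) (s : S) (a : A) : optQ M r s a ≤ optValue M r s :=
  (exists_optimal M r).choose_spec.2.1 s a

lemma exists_optQ_eq (r : Reward S A) (s : S) : ∃ a, optQ M r s a = optValue M r s :=
  ⟨_, (exists_optimal M r).choose_spec.2.2 s⟩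

end Bellman

/-! ### Measurability in the reward -/

section Measurability

variable {S A : Type*} [Fintype S] (M : MDP S A)

lemma measurable_iterate_step (π : S → A) (t : ℕ) (s : S) :
    Measurable fun r : Reward S A => (step M π)^[t] (fun x => r x (π x)) s := by
  induction t generalizing s with
  | zero => simp only [Function.iterate_zero, id_eq]; fun_prop
  | succ t ih =>
    simp only [Function.iterate_succ_apply']
    exact Finset.measurable_fun_sum _ fun s' _ => (ih s').const_mul _

lemma measurable_value (π : S → A) (s : S) : Measurable fun r : Reward S A => value M r π s :=
  measurable_of_tendsto_metrizable
    (f := fun (n : ℕ) (r : Reward S A) =>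
      ∑ t ∈ Finset.range n, M.disc ^ t * (step M π)^[t] (fun x => r x (π x)) s)
    (fun _ => Finset.measurable_fun_sum _ fun t _ => (measurable_iterate_step M π t s).const_mul _)
    (tendsto_pi_nhds.2 fun r => (summable_value M r π s).hasSum.tendsto_sum_nat)

variable [Fintype A]

lemma measurable_optValue (s : S) : Measurable fun r : Reward S A => optValue M r s := by
  classical
  exact Measurable.iSup fun π => measurable_value M π s

lemma measurable_optQ (s : S) (a : A) : Measurable fun r : Reward S A => optQ M r s a := by
  have h : Measurable fun r : Reward S A => ∑ s', M.trans s a s' * optValue M r s' :=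
    Finset.measurable_fun_sum _ fun s' _ => (measurable_optValue M s').const_mul _
  have h' : Measurable fun r : Reward S A => r s a := by fun_prop
  exact h'.add (h.const_mul _)

lemma measurable_immRegret (π : S → A) (s : S) (a : A) :
    Measurable fun r : Reward S A => immRegret M r π s a :=
  measurable_const.max ((measurable_optQ M s a).sub (measurable_optQ M s (π s)))

lemma measurableSet_discRegret_apply (ε : ℝ) (π : S → A) (s : S) (a : A) (c : Correctness) :
    MeasurableSet {r : Reward S A | discRegret M ε r π s a = c} := by
  have h0 : MeasurableSet {r : Reward S A | immRegret M r π s a = 0} :=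
    measurable_immRegret M π s a (measurableSet_singleton 0)
  have h1 : MeasurableSet {r : Reward S A | immRegret M r π s a < ε * (1 - M.disc)} :=
    measurable_immRegret M π s a measurableSet_Iio
  have : {r : Reward S A | discRegret M ε r π s a = c} =
      {r | immRegret M r π s a = 0 ∧ c = .correct} ∪
      {r | immRegret M r π s a ≠ 0 ∧ immRegret M r π s a < ε * (1 - M.disc) ∧ c = .approx} ∪
      {r | immRegret M r π s a ≠ 0 ∧ ¬ immRegret M r π s a < ε * (1 - M.disc) ∧
        c = .incorrect} := by
    ext r
    simp only [discRegret, Set.mem_ofPred_eq, Set.mem_union]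
    split_ifs <;> simp_all [eq_comm]
  rw [this]
  exact ((h0.inter (.const _)).union (h0.compl.inter (h1.inter (.const _)))).union
    (h0.compl.inter (h1.compl.inter (.const _)))

lemma measurableSet_discRegret (ε : ℝ) (π : S → A) (e : S → A → Correctness) :
    MeasurableSet {r : Reward S A | discRegret M ε r π = e} := by
  simp only [funext_iff, Set.ofPred_forall]
  exact .iInter fun s => .iInter fun a => measurableSet_discRegret_apply M ε π s a (e s a)

lemma measurableSet_aggRegret (ε : ℝ) (e : (S → A) → S → A → Correctness) :
    MeasurableSet {r : Reward S A | aggRegret M ε r = e} := by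
  classical
  simp only [funext_iff (f := aggRegret M ε _), Set.ofPred_forall]
  exact .iInter fun π => measurableSet_discRegret M ε π (e π)

end Measurability

/-! ### Entropy and mutual information of finite variables -/

section Information

/-- Hoeffding's lemma for a finitely supported distribution. -/
lemma sum_mul_exp_le {X : Type*} [Fintype X] (q : X → ℝ) (hq : ∀ x, 0 ≤ q x)
    (hq1 : ∑ x, q x = 1) (g : X → ℝ) (hg : ∀ x, |g x| ≤ 1) (l : ℝ) :
    ∑ x, q x * Real.exp (l * (g x - ∑ x', q x' * g x')) ≤ Real.exp (l ^ 2 / 2) := by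
  let _ : MeasurableSpace X := ⊤
  let μ : Measure X := ∑ x, ENNReal.ofReal (q x) • Measure.dirac x
  have hint : ∀ f : X → ℝ, ∫ x, f x ∂μ = ∑ x, q x * f x := fun f => by
    rw [integral_finsetSum_measure fun x _ => ?_]
    · exact Finset.sum_congr rfl fun x _ => by
        rw [integral_smul_measure, integral_dirac, ENNReal.toReal_ofReal (hq x), smul_eq_mul]
    · exact (integrable_dirac (by simp)).smul_measure ENNReal.ofReal_ne_top
  have : IsProbabilityMeasure μ := ⟨by
    simp only [μ, Measure.coe_finsetSum, Finset.sum_apply, Measure.smul_apply, measure_univ,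
      smul_eq_mul, mul_one]
    rw [← ENNReal.ofReal_sum_of_nonneg fun x _ => hq x, hq1, ENNReal.ofReal_one]⟩
  have h := (ProbabilityTheory.hasSubgaussianMGF_of_mem_Icc (μ := μ) (X := g) (a := -1) (b := 1)
    (measurable_of_finite g).aemeasurable
    (Filter.Eventually.of_forall fun x => abs_le.1 (hg x))).mgf_le l
  rw [ProbabilityTheory.mgf, hint, hint] at h
  -- The variance proxy for the interval `[-1, 1]` is the square of half its length, namely `1`.
  have h2 : ‖(1 : ℝ) - -1‖₊ / 2 = 1 := by
    rw [← NNReal.coe_inj]; norm_num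
  rw [h2] at h
  simpa using h

/-- The Gibbs variational inequality, pointwise. -/
lemma mul_add_sub_le_mul_log {p q : ℝ} (hp : 0 ≤ p) (hq : 0 ≤ q) (hpq : q = 0 → p = 0) (φ : ℝ) :
    p * φ + p - q * Real.exp φ ≤ p * Real.log (p / q) := by
  rcases hp.eq_or_lt with rfl | hp
  · have := mul_nonneg hq (Real.exp_pos φ).le
    simp only [zero_mul, zero_div, add_zero]
    linarith
  · have hq : 0 < q := lt_of_le_of_ne hq fun h => hp.ne' (hpq h.symm)
    -- This is `log t ≤ t - 1` at `t = q e^φ / p`, multiplied by `p` afterwards.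
    have h1 := Real.log_le_sub_one_of_pos (show 0 < q * Real.exp φ / p by positivity)
    rw [Real.log_div (by positivity) hp.ne', Real.log_mul hq.ne' (Real.exp_pos _).ne',
      Real.log_exp] at h1
    rw [Real.log_div hp.ne' hq.ne']
    have h2 := mul_le_mul_of_nonneg_left h1 hp.le
    have h3 : p * (q * Real.exp φ / p - 1) = q * Real.exp φ - p := by field_simp
    rw [h3] at h2
    linarith

variable {X Y : Type*} [Fintype X] [Fintype Y] {p : X → Y → ℝ}

lemma marginal_mul_eq_zero (hp : ∀ x y, 0 ≤ p x y) (x : X) (y : Y)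
    (h : (∑ y', p x y') * ∑ x', p x' y = 0) : p x y = 0 := by
  rcases mul_eq_zero.1 h with h | h
  · exact (Finset.sum_eq_zero_iff_of_nonneg fun y _ => hp x y).1 h y (Finset.mem_univ y)
  · exact (Finset.sum_eq_zero_iff_of_nonneg fun x _ => hp x y).1 h x (Finset.mem_univ x)

lemma marginal_mul_nonneg (hp : ∀ x y, 0 ≤ p x y) (x : X) (y : Y) :
    0 ≤ (∑ y', p x y') * ∑ x', p x' y :=
  mul_nonneg (Finset.sum_nonneg fun _ _ => hp _ _) (Finset.sum_nonneg fun _ _ => hp _ _)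

/-- Lower bound for the contribution of a single value `y` to the mutual information. -/
lemma le_sum_mul_log (hp : ∀ x y, 0 ≤ p x y) (hp1 : ∑ x, ∑ y, p x y = 1) (g : X → ℝ)
    (hg : ∀ x, |g x| ≤ 1) (y : Y) (l : ℝ) :
    l * (∑ x, p x y * g x - (∑ x, p x y) * ∑ x, (∑ y', p x y') * g x) -
        (∑ x, p x y) * (l ^ 2 / 2) ≤
      ∑ x, p x y * Real.log (p x y / ((∑ y', p x y') * ∑ x', p x' y)) := by
  set m := ∑ x, (∑ y', p x y') * g x with hm
  have h1 := sum_mul_exp_le (fun x => ∑ y', p x y')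
    (fun x => Finset.sum_nonneg fun y _ => hp x y) hp1 g hg l
  rw [← hm] at h1
  -- The test function is `φ = l (g - m) - l² / 2`. By Hoeffding's lemma the constant `-l² / 2`
  -- keeps the tilted product measure at mass at most `w`, which cancels the term `∑ p`.
  have h2 : ∑ x, (p x y * (l * (g x - m) - l ^ 2 / 2) + p x y -
      ((∑ y', p x y') * ∑ x', p x' y) * Real.exp (l * (g x - m) - l ^ 2 / 2)) ≤
      ∑ x, p x y * Real.log (p x y / ((∑ y', p x y') * ∑ x', p x' y)) :=
    Finset.sum_le_sum fun x _ => mul_add_sub_le_mul_log (hp x y) (marginal_mul_nonneg hp x y)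
      (marginal_mul_eq_zero hp x y) _
  refine le_trans ?_ h2
  set w := ∑ x, p x y with hw
  have hw0 : 0 ≤ w := Finset.sum_nonneg fun x _ => hp x y
  have h3 : ∑ x, ((∑ y', p x y') * w) * Real.exp (l * (g x - m) - l ^ 2 / 2) ≤ w := by
    have : ∀ x, ((∑ y', p x y') * w) * Real.exp (l * (g x - m) - l ^ 2 / 2) =
        w * Real.exp (-(l ^ 2 / 2)) * ((∑ y', p x y') * Real.exp (l * (g x - m))) := fun x => by
      rw [sub_eq_add_neg, Real.exp_add]; ring
    simp only [this, ← Finset.mul_sum]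
    calc _ ≤ w * Real.exp (-(l ^ 2 / 2)) * Real.exp (l ^ 2 / 2) :=
          mul_le_mul_of_nonneg_left h1 (by positivity)
      _ = w := by rw [mul_assoc, ← Real.exp_add, neg_add_cancel, Real.exp_zero, mul_one]
  have h4 : ∑ x, p x y * (l * (g x - m) - l ^ 2 / 2) =
      l * (∑ x, p x y * g x - w * m) - w * (l ^ 2 / 2) := by
    rw [hw, Finset.sum_mul, Finset.sum_mul, ← Finset.sum_sub_distrib, Finset.mul_sum,
      ← Finset.sum_sub_distrib]
    exact Finset.sum_congr rfl fun _ _ => by ring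
  rw [Finset.sum_sub_distrib, Finset.sum_add_distrib, h4]
  linarith

lemma mutualInfo_eq_sum_comm :
    mutualInfo p = ∑ y, ∑ x, p x y * Real.log (p x y / ((∑ y', p x y') * ∑ x', p x' y)) :=
  Finset.sum_comm

/-- If two disjoint events about `Y`, of probabilities at least `κ`, separate the conditional
means of a statistic of `X` with values in `[-1, 1]` by `d`, then `X` and `Y` have mutual
information at least `κ d² / 4`. -/
lemma le_mutualInfo (hp : ∀ x y, 0 ≤ p x y) (hp1 : ∑ x, ∑ y, p x y = 1) (g : X → ℝ)
    (hg : ∀ x, |g x| ≤ 1) (B C : Finset Y) (hBC : Disjoint B C) {κ d : ℝ} (hκ : 0 < κ)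
    (hd : 0 ≤ d) (hB : κ ≤ ∑ y ∈ B, ∑ x, p x y) (hC : κ ≤ ∑ y ∈ C, ∑ x, p x y)
    (hgB : d * ∑ y ∈ B, ∑ x, p x y ≤ ∑ y ∈ B, ∑ x, p x y * g x)
    (hgC : ∑ y ∈ C, ∑ x, p x y * g x ≤ 0) :
    κ * d ^ 2 / 4 ≤ mutualInfo p := by
  classical
  rw [mutualInfo_eq_sum_comm]
  set b := ∑ y ∈ B, ∑ x, p x y with hb
  set c := ∑ y ∈ C, ∑ x, p x y with hc
  set m := ∑ x, (∑ y', p x y') * g x with hm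
  have hterm := le_sum_mul_log hp hp1 g hg
  have h0 : ∀ y, 0 ≤ ∑ x, p x y * Real.log (p x y / ((∑ y', p x y') * ∑ x', p x' y)) :=
    fun y => by simpa using hterm y 0
  have hset : ∀ (T : Finset Y) (l : ℝ),
      l * (∑ y ∈ T, ∑ x, p x y * g x - (∑ y ∈ T, ∑ x, p x y) * m) -
        (∑ y ∈ T, ∑ x, p x y) * (l ^ 2 / 2) ≤
      ∑ y ∈ T, ∑ x, p x y * Real.log (p x y / ((∑ y', p x y') * ∑ x', p x' y)) := by
    intro T l
    refine le_trans (le_of_eq ?_) (Finset.sum_le_sum fun y _ => hterm y l)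
    rw [Finset.sum_sub_distrib, ← Finset.mul_sum, Finset.sum_sub_distrib, ← Finset.sum_mul,
      ← Finset.sum_mul]
  have hbc : 0 < b + c := by linarith
  -- The tilts `c d / (b + c)` on `B` and `-b d / (b + c)` on `C` are weighted so that the unknown
  -- overall mean `m` cancels on adding. What remains is `b c / (b + c) * d² / 2`, and `b, c ≥ κ`
  -- gives `b c / (b + c) ≥ κ / 2`.
  have hB' := hset B (c * d / (b + c))
  have hC' := hset C (-(b * d / (b + c)))
  rw [← hb] at hB'
  rw [← hc] at hC'
  have hunion : ∑ y ∈ B, ∑ x, p x y * Real.log (p x y / ((∑ y', p x y') * ∑ x', p x' y)) +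
      ∑ y ∈ C, ∑ x, p x y * Real.log (p x y / ((∑ y', p x y') * ∑ x', p x' y)) ≤
      ∑ y, ∑ x, p x y * Real.log (p x y / ((∑ y', p x y') * ∑ x', p x' y)) := by
    rw [← Finset.sum_union hBC]
    exact Finset.sum_le_sum_of_subset_of_nonneg (Finset.subset_univ _) fun y _ _ => h0 y
  refine le_trans ?_ ((add_le_add hB' hC').trans hunion)
  have hlB : c * d / (b + c) * (d * b) ≤ c * d / (b + c) * ∑ y ∈ B, ∑ x, p x y * g x :=
    mul_le_mul_of_nonneg_left hgB (div_nonneg (mul_nonneg (by linarith) hd) hbc.le)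
  have hlC : 0 ≤ -(b * d / (b + c)) * ∑ y ∈ C, ∑ x, p x y * g x :=
    mul_nonneg_of_nonpos_of_nonpos
      (neg_nonpos.2 (div_nonneg (mul_nonneg (by linarith) hd) hbc.le)) hgC
  have hcomp : c * d / (b + c) * (d * b) - c * d / (b + c) * (b * m) -
      b * ((c * d / (b + c)) ^ 2 / 2) + (-(-(b * d / (b + c)) * (c * m))) -
      c * ((-(b * d / (b + c))) ^ 2 / 2) = b * c / (b + c) * d ^ 2 / 2 := by
    field_simp
    ring
  have hmin : κ / 2 ≤ b * c / (b + c) := by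
    rw [le_div_iff₀ hbc]
    nlinarith [mul_le_mul_of_nonneg_left hB (show 0 ≤ c by linarith),
      mul_le_mul_of_nonneg_left hC (show 0 ≤ b by linarith)]
  have := mul_le_mul_of_nonneg_right hmin (sq_nonneg d)
  nlinarith

lemma mutualInfo_nonneg (hp : ∀ x y, 0 ≤ p x y) (hp1 : ∑ x, ∑ y, p x y = 1) :
    0 ≤ mutualInfo p := by
  rw [mutualInfo_eq_sum_comm]
  exact Finset.sum_nonneg fun y _ => by
    simpa using le_sum_mul_log hp hp1 0 (by simp) y 0

/-- The data processing inequality, for a function of the second variable. -/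
lemma mutualInfo_fiber_le {Z : Type*} [Fintype Z] [DecidableEq Z] (f : Y → Z)
    (hp : ∀ x y, 0 ≤ p x y) :
    mutualInfo (fun x z => ∑ y with f y = z, p x y) ≤ mutualInfo p := by
  set P : X → Z → ℝ := fun x z => ∑ y with f y = z, p x y with hP
  have hP0 : ∀ x z, 0 ≤ P x z := fun x z => Finset.sum_nonneg fun y _ => hp x y
  have hrow : ∀ x, ∑ z, P x z = ∑ y, p x y := fun x => Finset.sum_fiberwise _ _ _
  set a : X → ℝ := fun x => ∑ y, p x y with ha
  set q : Y → ℝ := fun y => ∑ x, p x y with hq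
  set Q : Z → ℝ := fun z => ∑ x, P x z with hQ
  have ha0 : ∀ x, 0 ≤ a x := fun x => Finset.sum_nonneg fun y _ => hp x y
  have hq0 : ∀ y, 0 ≤ q y := fun y => Finset.sum_nonneg fun x _ => hp x y
  have hQ0 : ∀ z, 0 ≤ Q z := fun z => Finset.sum_nonneg fun x _ => hP0 x z
  have hlhs : mutualInfo P =
      ∑ x, ∑ y, p x y * Real.log (P x (f y) / (a x * Q (f y))) := by
    unfold mutualInfo
    refine Finset.sum_congr rfl fun x _ => ?_
    rw [← Finset.sum_fiberwise Finset.univ f]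
    refine Finset.sum_congr rfl fun z _ => ?_
    rw [hrow x]
    change (∑ y with f y = z, p x y) * Real.log (P x z / (a x * Q z)) = _
    rw [Finset.sum_mul]
    refine Finset.sum_congr rfl fun y hy => ?_
    rw [(Finset.mem_filter.1 hy).2]
  have hpt : ∀ x y, p x y * Real.log (P x (f y) / (a x * Q (f y))) + p x y -
      q y * (P x (f y) / Q (f y)) ≤ p x y * Real.log (p x y / (a x * q y)) := by
    intro x y
    rcases (hp x y).eq_or_lt with h | h
    · rw [← h]
      have := mul_nonneg (hq0 y) (div_nonneg (hP0 x (f y)) (hQ0 (f y)))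
      simp only [zero_mul, zero_add, zero_sub]
      linarith
    · have ha : 0 < a x :=
        h.trans_le (Finset.single_le_sum (fun y _ => hp x y) (Finset.mem_univ y))
      have hq : 0 < q y :=
        h.trans_le (Finset.single_le_sum (f := fun x => p x y) (fun x _ => hp x y)
          (Finset.mem_univ x))
      have hPp : 0 < P x (f y) :=
        h.trans_le (Finset.single_le_sum (fun y _ => hp x y) (by simp))
      have hQp : 0 < Q (f y) :=
        hPp.trans_le (Finset.single_le_sum (f := fun x => P x (f y)) (fun x _ => hP0 x _)
          (Finset.mem_univ x))
      -- The test function is the logarithm of the coarse density ratio, so the left side reproduces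
      -- the coarse information up to a mass defect, whose sign is settled by `hmass`.
      have h1 := mul_add_sub_le_mul_log h.le (mul_pos ha hq).le
        (fun h0 => absurd h0 (mul_pos ha hq).ne') (Real.log (P x (f y) / (a x * Q (f y))))
      rw [Real.exp_log (by positivity)] at h1
      have h2 : a x * q y * (P x (f y) / (a x * Q (f y))) = q y * (P x (f y) / Q (f y)) := by
        field_simp
      rwa [h2] at h1
  have hmass : ∑ x, ∑ y, q y * (P x (f y) / Q (f y)) ≤ ∑ x, ∑ y, p x y := by
    rw [Finset.sum_comm, Finset.sum_comm (f := p)]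
    refine Finset.sum_le_sum fun y _ => ?_
    rw [← Finset.mul_sum, ← Finset.sum_div]
    exact mul_le_of_le_one_right (hq0 y) (div_self_le_one _)
  have hsum := Finset.sum_le_sum fun x (_ : x ∈ Finset.univ) =>
    Finset.sum_le_sum fun y (_ : y ∈ Finset.univ) => hpt x y
  simp only [Finset.sum_sub_distrib, Finset.sum_add_distrib] at hsum
  rw [hlhs]
  have : mutualInfo p = ∑ x, ∑ y, p x y * Real.log (p x y / (a x * q y)) := rfl
  rw [this]
  linarith

/-- Mutual information of the normalized weights as a difference of entropies. -/
lemma mul_mutualInfo_div (hp : ∀ x y, 0 ≤ p x y) {w : ℝ} (hw : ∑ x, ∑ y, p x y = w) :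
    w * mutualInfo (fun x y => p x y / w) =
      (∑ y, Real.negMulLog (∑ x, p x y) - Real.negMulLog w) -
        ∑ x, (∑ y, Real.negMulLog (p x y) - Real.negMulLog (∑ y, p x y)) := by
  have hterm : ∀ x y, w * (p x y / w * Real.log (p x y / w /
      ((∑ y', p x y' / w) * ∑ x', p x' y / w))) =
      p x y * Real.log (p x y) + p x y * Real.log w - p x y * Real.log (∑ y', p x y') -
        p x y * Real.log (∑ x', p x' y) := by
    intro x y
    rcases (hp x y).eq_or_lt with h | h
    · simp [← h]
    · have ha : 0 < ∑ y', p x y' :=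
        h.trans_le (Finset.single_le_sum (fun y _ => hp x y) (Finset.mem_univ y))
      have hq : 0 < ∑ x', p x' y :=
        h.trans_le (Finset.single_le_sum (f := fun x => p x y) (fun x _ => hp x y)
          (Finset.mem_univ x))
      have hwp : 0 < w := by
        rw [← hw]
        exact ha.trans_le (Finset.single_le_sum (f := fun x => ∑ y, p x y)
          (fun x _ => Finset.sum_nonneg fun y _ => hp x y) (Finset.mem_univ x))
      rw [← Finset.sum_div, ← Finset.sum_div]
      have : p x y / w / ((∑ y', p x y') / w * ((∑ x', p x' y) / w)) =
          p x y * w / ((∑ y', p x y') * ∑ x', p x' y) := by field_simp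
      rw [this, Real.log_div (by positivity) (by positivity), Real.log_mul h.ne' hwp.ne',
        Real.log_mul ha.ne' hq.ne']
      field_simp
      ring
  have hsum : w * mutualInfo (fun x y => p x y / w) = ∑ x, ∑ y,
      (p x y * Real.log (p x y) + p x y * Real.log w - p x y * Real.log (∑ y', p x y') -
        p x y * Real.log (∑ x', p x' y)) := by
    rw [mutualInfo, Finset.mul_sum]
    refine Finset.sum_congr rfl fun x _ => ?_
    rw [Finset.mul_sum]
    exact Finset.sum_congr rfl fun y _ => hterm x y
  rw [hsum]
  simp only [Finset.sum_sub_distrib, Finset.sum_add_distrib]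
  rw [Finset.sum_comm (f := fun x y => p x y * Real.log (∑ x', p x' y))]
  simp only [← Finset.sum_mul, hw, Real.negMulLog, neg_mul, Finset.sum_neg_distrib]
  ring

/-- Each weight is at most the total and `log` is monotone. This is the nonnegativity of conditional
entropy for unnormalized weights. -/
lemma negMulLog_sum_le {q : Y → ℝ} (hq : ∀ y, 0 ≤ q y) :
    Real.negMulLog (∑ y, q y) ≤ ∑ y, Real.negMulLog (q y) := by
  simp only [Real.negMulLog, neg_mul, Finset.sum_neg_distrib, Finset.sum_mul]
  refine neg_le_neg (Finset.sum_le_sum fun y _ => ?_)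
  rcases (hq y).eq_or_lt with h | h
  · simp [← h]
  · exact mul_le_mul_of_nonneg_left (Real.log_le_log h
      (Finset.single_le_sum (fun y _ => hq y) (Finset.mem_univ y))) h.le

end Information

/-! ### The Boltzmann expert and its trajectories -/

section Trajectories

variable {S A : Type*} [Fintype S] (M : MDP S A)

lemma trans_le_one (s : S) (a : A) (s' : S) : M.trans s a s' ≤ 1 :=
  (Finset.single_le_sum (fun s' _ => M.trans_nonneg s a s') (Finset.mem_univ s')).trans_eq
    (M.trans_sum s a)

variable [Fintype A] (β : ℝ)

lemma expert_nonneg (r : Reward S A) (s : S) (a : A) : 0 ≤ expert M β r s a :=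
  div_nonneg (Real.exp_pos _).le (Finset.sum_nonneg fun _ _ => (Real.exp_pos _).le)

lemma sum_exp_optQ_pos [Nonempty A] (r : Reward S A) (s : S) :
    0 < ∑ a, Real.exp (β * optQ M r s a) :=
  Finset.sum_pos (fun _ _ => Real.exp_pos _) Finset.univ_nonempty

lemma sum_expert [Nonempty A] (r : Reward S A) (s : S) : ∑ a, expert M β r s a = 1 := by
  simp only [expert, ← Finset.sum_div]
  exact div_self (sum_exp_optQ_pos M β r s).ne'

lemma expert_le_one (r : Reward S A) (s : S) (a : A) : expert M β r s a ≤ 1 :=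
  have : Nonempty A := ⟨a⟩
  (Finset.single_le_sum (fun a _ => expert_nonneg M β r s a) (Finset.mem_univ a)).trans_eq
    (sum_expert M β r s)

lemma expert_le_exp_mul {β : ℝ} (hβ : 0 ≤ β) (r : Reward S A) (s : S) {a a' : A} {c : ℝ}
    (h : c ≤ optQ M r s a - optQ M r s a') :
    expert M β r s a' ≤ Real.exp (-(β * c)) * expert M β r s a := by
  have : Nonempty A := ⟨a⟩
  rw [expert, expert, mul_div_assoc', ← Real.exp_add]
  refine div_le_div_of_nonneg_right (Real.exp_le_exp.2 ?_) (sum_exp_optQ_pos M β r s).le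
  nlinarith

lemma expert_mono {β : ℝ} (hβ : 0 ≤ β) (r : Reward S A) (s : S) {a a' : A}
    (h : optQ M r s a' ≤ optQ M r s a) : expert M β r s a' ≤ expert M β r s a := by
  simpa using expert_le_exp_mul M hβ r s (sub_nonneg.2 h)

/-- A best action has the largest of `|A|` probabilities that sum to one. -/
lemma inv_card_le_expert {β : ℝ} (hβ : 0 ≤ β) (r : Reward S A) (s : S) {a : A}
    (h : ∀ a', optQ M r s a' ≤ optQ M r s a) :
    ((Fintype.card A : ℝ))⁻¹ ≤ expert M β r s a := by
  have : Nonempty A := ⟨a⟩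
  have h1 : ∑ a', expert M β r s a' ≤ ∑ _a' : A, expert M β r s a :=
    Finset.sum_le_sum fun a' _ => expert_mono M hβ r s (h a')
  rw [sum_expert, Finset.sum_const, Finset.card_univ, nsmul_eq_mul] at h1
  rw [inv_eq_one_div, div_le_iff₀ (by exact_mod_cast Fintype.card_pos)]
  linarith

lemma measurable_expert (s : S) (a : A) : Measurable fun r => expert M β r s a :=
  ((measurable_optQ M s a).const_mul β).exp.div
    (Finset.measurable_fun_sum _ fun a' _ => ((measurable_optQ M s a').const_mul β).exp)

variable {m : ℕ}

lemma trajLik_nonneg (r : Reward S A) (t : Traj S A m) : 0 ≤ trajLik M β r t :=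
  mul_nonneg (Finset.prod_nonneg fun _ _ => expert_nonneg _ _ _ _ _)
    (Finset.prod_nonneg fun _ _ => M.trans_nonneg _ _ _)

lemma trajLik_le_one (r : Reward S A) (t : Traj S A m) : trajLik M β r t ≤ 1 :=
  mul_le_one₀
    (Finset.prod_le_one (fun _ _ => expert_nonneg _ _ _ _ _) fun _ _ => expert_le_one _ _ _ _ _)
    (Finset.prod_nonneg fun _ _ => M.trans_nonneg _ _ _)
    (Finset.prod_le_one (fun _ _ => M.trans_nonneg _ _ _) fun _ _ => trans_le_one _ _ _ _)

lemma measurable_trajLik (t : Traj S A m) : Measurable fun r => trajLik M β r t :=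
  (Finset.measurable_fun_prod _ fun j _ => measurable_expert M β (t j).1 (t j).2).mul_const _

/-- Peeling off the last pair lets the induction on the length sum out the final transition and
action, which contribute a factor one and leave the first pair untouched. -/
lemma trajLik_snoc (r : Reward S A) (t : Traj S A m) (x : S × A) :
    trajLik M β r (Fin.snoc t x : Traj S A (m + 1)) =
      trajLik M β r t *
        (M.trans (t (Fin.last m)).1 (t (Fin.last m)).2 x.1 * expert M β r x.1 x.2) := by
  have h1 : ∏ j : Fin (m + 2), expert M β r ((Fin.snoc t x : Traj S A (m + 1)) j).1
      ((Fin.snoc t x : Traj S A (m + 1)) j).2 =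
      (∏ j, expert M β r (t j).1 (t j).2) * expert M β r x.1 x.2 := by
    rw [Fin.prod_univ_castSucc]
    simp only [Fin.snoc_castSucc, Fin.snoc_last]
  have h2 : ∏ j : Fin (m + 1), M.trans ((Fin.snoc t x : Traj S A (m + 1)) j.castSucc).1
      ((Fin.snoc t x : Traj S A (m + 1)) j.castSucc).2
      ((Fin.snoc t x : Traj S A (m + 1)) j.succ).1 =
      (∏ j : Fin m, M.trans (t j.castSucc).1 (t j.castSucc).2 (t j.succ).1) *
        M.trans (t (Fin.last m)).1 (t (Fin.last m)).2 x.1 := by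
    rw [Fin.prod_univ_castSucc]
    simp only [Fin.snoc_castSucc, Fin.succ_last, Fin.snoc_last, Fin.succ_castSucc]
  rw [trajLik, trajLik, h1, h2]
  ring

variable [Nonempty A]

/-- The first state-action pair of the expert's trajectories has the expected law. -/
lemma sum_trajLik_mul (r : Reward S A) (F : S × A → ℝ) :
    ∑ t : Traj S A m, trajLik M β r t * F (t 0) = ∑ x : S × A, expert M β r x.1 x.2 * F x := by
  induction m with
  | zero =>
    refine Fintype.sum_equiv (Equiv.funUnique (Fin 1) (S × A)) _ _ fun t => ?_
    simp [trajLik]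
  | succ m ih =>
    rw [← ih, ← (Fin.snocEquiv fun _ : Fin (m + 1 + 1) => S × A).sum_comp,
      Fintype.sum_prod_type_right]
    refine Finset.sum_congr rfl fun t _ => ?_
    have h0 : ∀ x : S × A, (Fin.snoc t x : Traj S A (m + 1)) 0 = t 0 := fun x => by
      rw [← Fin.castSucc_zero, Fin.snoc_castSucc (α := fun _ => S × A)]
    have h1 : ∑ x : S × A,
        M.trans (t (Fin.last m)).1 (t (Fin.last m)).2 x.1 * expert M β r x.1 x.2 = 1 := by
      rw [Fintype.sum_prod_type]
      simp only [← Finset.mul_sum, sum_expert, mul_one, M.trans_sum]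
    change ∑ x : S × A, trajLik M β r (Fin.snoc t x : Traj S A (m + 1)) *
      F ((Fin.snoc t x : Traj S A (m + 1)) 0) = _
    simp only [h0, trajLik_snoc, ← Finset.sum_mul, ← Finset.mul_sum, h1, mul_one]

variable [DecidableEq S]

lemma sum_demoProb_mul (r : Reward S A) (s : S) (F : A → ℝ) :
    ∑ t : Traj S A m, demoProb M β r s t * F (t 0).2 = ∑ a, expert M β r s a * F a := by
  have h := sum_trajLik_mul M β (m := m) r fun x => if x.1 = s then F x.2 else 0
  rw [Fintype.sum_prod_type] at h
  simp only [mul_ite, mul_zero] at h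
  rw [Finset.sum_eq_single s (by intro b _ hb; simp [hb]) (by simp)] at h
  simpa [demoProb, ite_mul] using h

end Trajectories

/-! ### Data likelihood, posterior and averaged demonstrations -/

section Demonstrations

variable {S A : Type*} [Fintype S] [Fintype A] (M : MDP S A) (β : ℝ) {m : ℕ}

section Data

variable {len : ℕ → ℕ} {n : ℕ} (D : Data S A len n)

lemma dataLik_nonneg (r : Reward S A) : 0 ≤ dataLik M β D r :=
  Finset.prod_nonneg fun _ _ => trajLik_nonneg _ _ _ _

lemma dataLik_le_one (r : Reward S A) : dataLik M β D r ≤ 1 :=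
  Finset.prod_le_one (fun _ _ => trajLik_nonneg _ _ _ _) fun _ _ => trajLik_le_one _ _ _ _

lemma measurable_dataLik : Measurable (dataLik M β D) :=
  Finset.measurable_fun_prod _ fun i _ => measurable_trajLik M β (D i)

variable (prior : Measure (Reward S A))

/-- If the data has evidence zero, then the posterior is the zero measure. -/
lemma posterior_eq_zero (h : ∫⁻ r, ENNReal.ofReal (dataLik M β D r) ∂prior = 0) :
    posterior M β prior D = 0 := by
  have : prior.withDensity (fun r => ENNReal.ofReal (dataLik M β D r)) = 0 := by
    rw [← Measure.measure_univ_eq_zero, withDensity_apply _ MeasurableSet.univ,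
      Measure.restrict_univ, h]
  rw [posterior, this, smul_zero]

variable [IsProbabilityMeasure prior]

lemma lintegral_dataLik_ne_top : ∫⁻ r, ENNReal.ofReal (dataLik M β D r) ∂prior ≠ ∞ := by
  refine ne_top_of_le_ne_top ENNReal.one_ne_top
    ((lintegral_mono (g := fun _ => 1) fun r => ?_).trans_eq (by simp))
  rw [← ENNReal.ofReal_one]
  exact ENNReal.ofReal_le_ofReal (dataLik_le_one M β D r)

lemma isProbabilityMeasure_posterior
    (h : ∫⁻ r, ENNReal.ofReal (dataLik M β D r) ∂prior ≠ 0) :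
    IsProbabilityMeasure (posterior M β prior D) := ⟨by
  rw [posterior, Measure.smul_apply, withDensity_apply _ MeasurableSet.univ,
    Measure.restrict_univ, smul_eq_mul,
    ENNReal.inv_mul_cancel h (lintegral_dataLik_ne_top M β D prior)]⟩

end Data

lemma integrable_expert (μ : Measure (Reward S A)) [IsFiniteMeasure μ] (s : S)
    (a : A) : Integrable (fun r => expert M β r s a) μ :=
  Integrable.of_bound (measurable_expert M β s a).aestronglyMeasurable 1
    (Filter.Eventually.of_forall fun r => by
      rw [Real.norm_eq_abs, abs_of_nonneg (expert_nonneg M β r s a)]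
      exact expert_le_one M β r s a)

variable [DecidableEq S]

lemma demoProb_nonneg (r : Reward S A) (s : S) (t : Traj S A m) : 0 ≤ demoProb M β r s t := by
  unfold demoProb
  split_ifs
  exacts [trajLik_nonneg M β r t, le_rfl]

lemma demoProb_le_one (r : Reward S A) (s : S) (t : Traj S A m) : demoProb M β r s t ≤ 1 := by
  unfold demoProb
  split_ifs
  exacts [trajLik_le_one M β r t, zero_le_one]

lemma measurable_demoProb (s : S) (t : Traj S A m) :
    Measurable fun r => demoProb M β r s t := by
  unfold demoProb
  split_ifs
  exacts [measurable_trajLik M β t, measurable_const]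

lemma integrable_demoProb (μ : Measure (Reward S A)) [IsFiniteMeasure μ] (s : S)
    (t : Traj S A m) : Integrable (fun r => demoProb M β r s t) μ :=
  Integrable.of_bound (measurable_demoProb M β s t).aestronglyMeasurable 1
    (Filter.Eventually.of_forall fun r => by
      rw [Real.norm_eq_abs, abs_of_nonneg (demoProb_nonneg M β r s t)]
      exact demoProb_le_one M β r s t)

lemma sum_integral_demoProb_mul [Nonempty A] (μ : Measure (Reward S A)) [IsFiniteMeasure μ]
    (s : S) (F : A → ℝ) :
    ∑ t : Traj S A m, (∫ r, demoProb M β r s t ∂μ) * F (t 0).2 =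
      ∫ r, ∑ a, expert M β r s a * F a ∂μ := by
  simp only [← integral_mul_const]
  rw [← integral_finsetSum _ fun t _ => (integrable_demoProb M β μ s t).mul_const _]
  simp only [sum_demoProb_mul]

lemma sum_integral_demoProb [Nonempty A] (μ : Measure (Reward S A)) [IsFiniteMeasure μ]
    (s : S) : ∑ t : Traj S A m, ∫ r, demoProb M β r s t ∂μ = μ.real Set.univ := by
  simpa [sum_expert] using sum_integral_demoProb_mul M β (m := m) μ s fun _ => 1

end Demonstrations

/-! ### Lower bound for the information gained before PAC -/

section InformationGain

variable {S A : Type*} [Fintype S] (M : MDP S A)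

lemma discRegret_eq_correct_iff {ε : ℝ} (r : Reward S A) (π : S → A) (s : S) (a : A) :
    discRegret M ε r π s a = .correct ↔ optQ M r s a ≤ optQ M r s (π s) := by
  have : immRegret M r π s a = 0 ↔ optQ M r s a ≤ optQ M r s (π s) := by
    simp [immRegret]
  rw [← this, discRegret]
  split_ifs <;> simp_all

lemma discRegret_eq_incorrect_iff {ε : ℝ} (hε : 0 < ε) (r : Reward S A) (π : S → A) (s : S)
    (a : A) : discRegret M ε r π s a = .incorrect ↔
      ε * (1 - M.disc) ≤ optQ M r s a - optQ M r s (π s) := by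
  have hpos : 0 < ε * (1 - M.disc) := mul_pos hε (sub_pos.2 M.disc_lt_one)
  have : ε * (1 - M.disc) ≤ immRegret M r π s a ↔
      ε * (1 - M.disc) ≤ optQ M r s a - optQ M r s (π s) := by
    simp [immRegret, hpos.not_ge]
  rw [← this, discRegret]
  split_ifs with h1 h2
  · simp [h1, hpos]
  · simpa using h2
  · simpa using h2

variable [Fintype A]

lemma integral_sum_expert_sub (β : ℝ) (ν : Measure (Reward S A)) [IsFiniteMeasure ν] (s : S)
    (J : Finset A) (b : A) :
    ∫ r, ∑ a ∈ J, (expert M β r s a - expert M β r s b) ∂ν =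
      ∑ a ∈ J, ∫ r, (expert M β r s a - expert M β r s b) ∂ν :=
  integral_finsetSum _ fun a _ => (integrable_expert M β ν s a).sub (integrable_expert M β ν s b)

lemma sum_measureReal_discRegret (ε : ℝ) (μ : Measure (Reward S A)) [IsFiniteMeasure μ]
    (π : S → A) (T : Finset (S → A → Correctness)) :
    ∑ e ∈ T, μ.real {r | discRegret M ε r π = e} = μ.real {r | discRegret M ε r π ∈ T} :=
  sum_measureReal_preimage_singleton T fun e _ => measurableSet_discRegret M ε π e

variable [Nonempty A]

/-- If the apprentice is incorrect in `s`, then the actions to which it is incorrect are together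
much more likely than its own action. -/
lemma le_sum_expert_sub {β ε : ℝ} (hβ : 0 < β) (hε : 0 < ε) (r : Reward S A) (π : S → A) (s : S)
    (h : ∃ a, discRegret M ε r π s a = .incorrect) :
    (1 - Real.exp (-(β * (1 - M.disc) * ε))) / Fintype.card A ≤
      ∑ a with discRegret M ε r π s a = .incorrect,
        (expert M β r s a - expert M β r s (π s)) := by
  set x := β * (1 - M.disc) * ε with hx
  have hx0 : 0 < x := mul_pos (mul_pos hβ (sub_pos.2 M.disc_lt_one)) hε
  have hexp : 0 ≤ 1 - Real.exp (-x) := by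
    rw [sub_nonneg, Real.exp_le_one_iff]; linarith
  have hterm : ∀ a, discRegret M ε r π s a = .incorrect →
      (1 - Real.exp (-x)) * expert M β r s a ≤ expert M β r s a - expert M β r s (π s) := by
    intro a ha
    have h1 := expert_le_exp_mul M hβ.le r s ((discRegret_eq_incorrect_iff M hε r π s a).1 ha)
    rw [show β * (ε * (1 - M.disc)) = x by rw [hx]; ring] at h1
    linarith
  obtain ⟨a₀, ha₀⟩ := h
  -- An optimal action beats the apprentice by at least as much as any other action does, so it is
  -- itself incorrect and carries expert probability at least `1 / |A|`.
  obtain ⟨b, hb⟩ := exists_optQ_eq M r s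
  have hbmax : ∀ a, optQ M r s a ≤ optQ M r s b := fun a => hb ▸ optQ_le_optValue M r s a
  have hbinc : discRegret M ε r π s b = .incorrect := by
    rw [discRegret_eq_incorrect_iff M hε] at ha₀ ⊢
    linarith [hbmax a₀]
  calc (1 - Real.exp (-x)) / Fintype.card A ≤ (1 - Real.exp (-x)) * expert M β r s b := by
        rw [div_eq_mul_inv]
        exact mul_le_mul_of_nonneg_left (inv_card_le_expert M hβ.le r s hbmax) hexp
    _ ≤ expert M β r s b - expert M β r s (π s) := hterm b hbinc
    _ ≤ _ := Finset.single_le_sum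
        (f := fun a => expert M β r s a - expert M β r s (π s))
        (fun a ha => (mul_nonneg hexp (expert_nonneg M β r s a)).trans
          (hterm a (Finset.mem_filter.1 ha).2)) (by simp [hbinc])

/-- An action that most likely is optimal is optimal with probability at least `1 / |A|`. -/
lemma inv_card_le_measureReal (μ : Measure (Reward S A)) [IsProbabilityMeasure μ] (s : S) (b : A)
    (hb : ∀ a, μ {r | optValue M r s - optQ M r s a = 0} ≤
      μ {r | optValue M r s - optQ M r s b = 0}) :
    (Fintype.card A : ℝ)⁻¹ ≤ μ.real {r | optValue M r s - optQ M r s b = 0} := by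
  have hcover : (Set.univ : Set (Reward S A)) ⊆
      ⋃ a ∈ (Finset.univ : Finset A), {r | optValue M r s - optQ M r s a = 0} := fun r _ => by
    obtain ⟨a, ha⟩ := exists_optQ_eq M r s
    simpa using ⟨a, by rw [ha, sub_self]⟩
  have h1 : (1 : ℝ) ≤ ∑ a : A, μ.real {r | optValue M r s - optQ M r s a = 0} := by
    calc (1 : ℝ) = μ.real Set.univ := by simp
      _ ≤ _ := measureReal_mono hcover (measure_ne_top _ _)
      _ ≤ _ := measureReal_biUnion_finset_le _ _
  have h2 : ∑ a : A, μ.real {r | optValue M r s - optQ M r s a = 0} ≤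
      ∑ _a : A, μ.real {r | optValue M r s - optQ M r s b = 0} :=
    Finset.sum_le_sum fun a _ => ENNReal.toReal_mono (measure_ne_top _ _) (hb a)
  rw [Finset.sum_const, Finset.card_univ, nsmul_eq_mul] at h2
  rw [inv_eq_one_div, div_le_iff₀ (by exact_mod_cast Fintype.card_pos)]
  linarith

/-- Given a value of the discretized regret with an incorrect entry in `s`, some action is expected
to be much more likely than the action of the apprentice. -/
lemma exists_le_integral_expert_sub {β ε : ℝ} (hβ : 0 < β) (hε : 0 < ε)
    (hA : 2 ≤ Fintype.card A) (μ : Measure (Reward S A)) [IsFiniteMeasure μ] (π : S → A) (s : S)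
    (e : S → A → Correctness) (he : ∃ a, e s a = .incorrect) :
    ∃ a, a ≠ π s ∧
      (1 - Real.exp (-(β * (1 - M.disc) * ε))) / (Fintype.card A * (Fintype.card A - 1)) *
          μ.real {r | discRegret M ε r π = e} ≤
        ∫ r in {r | discRegret M ε r π = e}, (expert M β r s a - expert M β r s (π s)) ∂μ := by
  set U : Set (Reward S A) := {r | discRegret M ε r π = e} with hU
  have hUm : MeasurableSet U := measurableSet_discRegret M ε π e
  set c := 1 - Real.exp (-(β * (1 - M.disc) * ε)) with hc
  have hc0 : 0 ≤ c := by
    have : 0 ≤ β * (1 - M.disc) * ε :=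
      (mul_pos (mul_pos hβ (sub_pos.2 M.disc_lt_one)) hε).le
    rw [hc, sub_nonneg, Real.exp_le_one_iff]; linarith
  have hA' : (2 : ℝ) ≤ Fintype.card A := by exact_mod_cast hA
  rcases U.eq_empty_or_nonempty with hemp | ⟨r₀, hr₀⟩
  · have : Nontrivial A := Fintype.one_lt_card_iff_nontrivial.1 hA
    obtain ⟨a, ha⟩ := exists_ne (π s)
    exact ⟨a, ha, by simp [hemp]⟩
  -- The optimal action may vary over the rewards in `U`, but the set `J` of incorrect actions is
  -- determined by `e`. The sum over `J` can therefore be integrated first; pigeonholing in `J`,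
  -- which misses `π s`, then costs the factor `|A| - 1`.
  set J : Finset A := {a | e s a = .incorrect} with hJ
  have hπJ : π s ∉ J := by
    have : discRegret M ε r₀ π s (π s) = .correct :=
      (discRegret_eq_correct_iff M r₀ π s (π s)).2 le_rfl
    rw [hr₀] at this
    simp [hJ, this]
  have hJne : J.Nonempty := he.imp fun a ha => by simp [hJ, ha]
  have hJcard : (J.card : ℝ) ≤ Fintype.card A - 1 := by
    have : J.card < Fintype.card A := by
      rw [← Finset.card_univ]
      exact Finset.card_lt_card ⟨Finset.subset_univ _, fun h => hπJ (h (Finset.mem_univ _))⟩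
    have : J.card + 1 ≤ Fintype.card A := this
    have : (J.card : ℝ) + 1 ≤ Fintype.card A := by exact_mod_cast this
    linarith
  have hint : c / Fintype.card A * μ.real U ≤
      ∑ a ∈ J, ∫ r in U, (expert M β r s a - expert M β r s (π s)) ∂μ := by
    rw [← integral_sum_expert_sub]
    calc c / Fintype.card A * μ.real U = ∫ _ in U, c / Fintype.card A ∂μ := by
          simp [mul_comm]
      _ ≤ _ := setIntegral_mono_on (integrable_const _)
          (integrable_finsetSum _ fun a _ =>
            (integrable_expert M β _ s a).sub (integrable_expert M β _ s (π s))) hUm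
          fun r hr => by
            have hr' : discRegret M ε r π = e := hr
            have := le_sum_expert_sub M hβ hε r π s (by rw [hr']; exact he)
            rwa [hr'] at this
  obtain ⟨a, haJ, ha⟩ := Finset.exists_le_of_sum_le (s := J)
    (f := fun _ => c / (Fintype.card A * (Fintype.card A - 1)) * μ.real U) hJne (by
      refine le_trans ?_ hint
      rw [Finset.sum_const, nsmul_eq_mul]
      have h1 : (Fintype.card A - 1 : ℝ) *
          (c / (Fintype.card A * (Fintype.card A - 1)) * μ.real U) =
          c / Fintype.card A * μ.real U := by
        have : (Fintype.card A - 1 : ℝ) ≠ 0 := by linarith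
        field_simp
      rw [← h1]
      exact mul_le_mul_of_nonneg_right hJcard (mul_nonneg (div_nonneg hc0
        (mul_nonneg (by linarith) (by linarith))) measureReal_nonneg))
  exact ⟨a, fun h => hπJ (h ▸ haJ), ha⟩

variable [DecidableEq S] [DecidableEq A]

/-- If the regret of the apprentice is large with probability more than `δ`, then a demonstration
from some state carries at least `eigMin` of information about the discretized regret. -/
lemma exists_eigMin_le_mutualInfo {β ε δ : ℝ} (hβ : 0 < β) (hε : 0 < ε) (hδ : 0 < δ)
    (hδ' : δ ≤ 1 / 2) (hA : 2 ≤ Fintype.card A) (μ : Measure (Reward S A))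
    [IsProbabilityMeasure μ] (π : S → A)
    (hπ : ∀ s a, μ {r | optValue M r s - optQ M r s a = 0} ≤
      μ {r | optValue M r s - optQ M r s (π s) = 0})
    (hreg : ENNReal.ofReal δ < μ {r | ε ≤ regret M r π}) (m : ℕ) :
    ∃ s, eigMin M β ε δ ≤ mutualInfo (fun (t : Traj S A m) (e : S → A → Correctness) =>
      ∫ r in {r | discRegret M ε r π = e}, demoProb M β r s t ∂μ) := by
  have hA' : (2 : ℝ) ≤ Fintype.card A := by exact_mod_cast hA
  have : Nontrivial A := Fintype.one_lt_card_iff_nontrivial.1 hA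
  have hS : Nonempty S := nonempty_state M
  have hS1 : (1 : ℝ) ≤ Fintype.card S := by exact_mod_cast Fintype.card_pos
  -- a state in which the apprentice is incorrect with probability at least `δ / |S|`
  obtain ⟨s, hs⟩ : ∃ s, δ / Fintype.card S ≤
      μ.real {r | ∃ a, discRegret M ε r π s a = .incorrect} := by
    have hcover : {r | ε ≤ regret M r π} ⊆
        ⋃ s ∈ (Finset.univ : Finset S), {r | ∃ a, discRegret M ε r π s a = .incorrect} := by
      intro r hr
      obtain ⟨s, hs⟩ := exists_of_le_regret M r π hr
      obtain ⟨a, ha⟩ := exists_optQ_eq M r s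
      simp only [Finset.mem_univ, Set.iUnion_true, Set.mem_iUnion]
      exact ⟨s, a, (discRegret_eq_incorrect_iff M hε r π s a).2 (by rw [ha]; exact hs)⟩
    have h1 : δ ≤ ∑ s, μ.real {r | ∃ a, discRegret M ε r π s a = .incorrect} :=
      calc δ ≤ μ.real {r | ε ≤ regret M r π} :=
            ((ENNReal.ofReal_lt_iff_lt_toReal hδ.le (measure_ne_top _ _)).1 hreg).le
        _ ≤ _ := measureReal_mono hcover (measure_ne_top _ _)
        _ ≤ _ := measureReal_biUnion_finset_le _ _
    obtain ⟨s, -, hs⟩ := Finset.exists_le_of_sum_le (s := (Finset.univ : Finset S))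
      (f := fun _ => δ / Fintype.card S) Finset.univ_nonempty (by
        refine le_trans (le_of_eq ?_) h1
        rw [Finset.sum_const, Finset.card_univ, nsmul_eq_mul]
        field_simp)
    exact ⟨s, hs⟩
  refine ⟨s, ?_⟩
  set p : Traj S A m → (S → A → Correctness) → ℝ := fun t e =>
    ∫ r in {r | discRegret M ε r π = e}, demoProb M β r s t ∂μ with hp
  have hp0 : ∀ t e, 0 ≤ p t e := fun t e => integral_nonneg fun r => demoProb_nonneg M β r s t
  have hcol : ∀ e, ∑ t, p t e = μ.real {r | discRegret M ε r π = e} := fun e => by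
    simp [hp, sum_integral_demoProb]
  have hp1 : ∑ t, ∑ e, p t e = 1 := by
    rw [Finset.sum_comm]
    simp only [hcol]
    rw [sum_measureReal_discRegret]
    simp
  set d := (1 - Real.exp (-(β * (1 - M.disc) * ε))) / (Fintype.card A * (Fintype.card A - 1))
    with hd
  have hd0 : 0 ≤ d := by
    have : 0 ≤ β * (1 - M.disc) * ε :=
      (mul_pos (mul_pos hβ (sub_pos.2 M.disc_lt_one)) hε).le
    refine div_nonneg ?_ (mul_nonneg (by linarith) (by linarith))
    rw [sub_nonneg, Real.exp_le_one_iff]; linarith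
  -- the action that a value of the discretized regret makes likely, and the best such action
  have hα : ∀ e : S → A → Correctness, ∃ a, (∃ a', e s a' = .incorrect) → a ≠ π s ∧
      d * μ.real {r | discRegret M ε r π = e} ≤
        ∫ r in {r | discRegret M ε r π = e}, (expert M β r s a - expert M β r s (π s)) ∂μ := by
    intro e
    by_cases he : ∃ a', e s a' = .incorrect
    · obtain ⟨a, ha⟩ := exists_le_integral_expert_sub M hβ hε hA μ π s e he
      exact ⟨a, fun _ => ha⟩
    · exact ⟨π s, fun h => absurd h he⟩
  choose α hα using hα
  set I : Finset (S → A → Correctness) := {e | ∃ a, e s a = .incorrect} with hI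
  -- The mass `δ / |S|` of incorrect patterns is split among at most `|A| - 1` favoured actions; `κ`
  -- is the share some action must reach.
  set κ := δ / (Fintype.card S * (Fintype.card A - 1)) with hκ
  have hκ0 : 0 < κ := div_pos hδ (mul_pos (by linarith) (by linarith))
  obtain ⟨a, haπ, ha⟩ : ∃ a, a ≠ π s ∧
      κ ≤ ∑ e ∈ I with α e = a, μ.real {r | discRegret M ε r π = e} := by
    have h1 : ∑ a ∈ Finset.univ.erase (π s), ∑ e ∈ I with α e = a,
        μ.real {r | discRegret M ε r π = e} = ∑ e ∈ I, μ.real {r | discRegret M ε r π = e} :=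
      Finset.sum_fiberwise_of_maps_to (fun e he => Finset.mem_erase.2
        ⟨(hα e (Finset.mem_filter.1 he).2).1, Finset.mem_univ _⟩) _
    have h2 : ∑ e ∈ I, μ.real {r | discRegret M ε r π = e} =
        μ.real {r | ∃ a, discRegret M ε r π s a = .incorrect} := by
      rw [sum_measureReal_discRegret]
      simp [hI]
    have hcard : ((Finset.univ.erase (π s)).card : ℝ) = Fintype.card A - 1 := by
      rw [Finset.card_erase_of_mem (Finset.mem_univ _), Finset.card_univ,
        Nat.cast_sub (by omega), Nat.cast_one]
    obtain ⟨a, ha, hle⟩ := Finset.exists_le_of_sum_le (s := Finset.univ.erase (π s))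
      (f := fun _ => κ)
      ⟨_, Finset.mem_erase.2 ⟨(exists_ne (π s)).choose_spec, Finset.mem_univ _⟩⟩ (by
        refine le_trans (le_of_eq ?_) (hs.trans (h2.symm.trans h1.symm).le)
        rw [Finset.sum_const, nsmul_eq_mul, hcard, hκ]
        have : (Fintype.card A - 1 : ℝ) ≠ 0 := by linarith
        field_simp)
    exact ⟨a, (Finset.mem_erase.1 ha).1, hle⟩
  set C : Finset (S → A → Correctness) := {e | ∀ a, e s a = .correct} with hC
  -- Only the first action is used: the conditional mean of `g` is the expert's preference for `a`
  -- over `π s` in `s`, whatever the length of the demonstration.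
  set g : Traj S A m → ℝ := fun t =>
    (if (t 0).2 = a then 1 else 0) - (if (t 0).2 = π s then 1 else 0) with hg
  have hg1 : ∀ t, |g t| ≤ 1 := fun t => by
    simp only [hg]
    split_ifs <;> norm_num
  have hGe : ∀ e, ∑ t, p t e * g t =
      ∫ r in {r | discRegret M ε r π = e}, (expert M β r s a - expert M β r s (π s)) ∂μ := by
    intro e
    rw [sum_integral_demoProb_mul M β _ s
      fun b => (if b = a then 1 else 0) - (if b = π s then 1 else 0)]
    simp [mul_sub, Finset.sum_sub_distrib]
  have hCκ : κ ≤ ∑ e ∈ C, ∑ t, p t e := by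
    simp only [hcol]
    rw [sum_measureReal_discRegret]
    -- Here `δ ≤ 1 / 2` enters: `κ ≤ 1 / (2 (|A| - 1)) ≤ 1 / |A|` for `|A| ≥ 2`.
    have h1 : κ ≤ (Fintype.card A : ℝ)⁻¹ := by
      rw [hκ, inv_eq_one_div, div_le_div_iff₀ (mul_pos (by linarith) (by linarith))
        (by linarith)]
      nlinarith
    refine (h1.trans (inv_card_le_measureReal M μ s (π s) (hπ s))).trans
      (measureReal_mono fun r hr => ?_)
    have hr' : optValue M r s - optQ M r s (π s) = 0 := hr
    simp only [hC, Finset.mem_filter, Finset.mem_univ, true_and, Set.mem_ofPred_eq]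
    intro b
    rw [discRegret_eq_correct_iff]
    linarith [optQ_le_optValue M r s b]
  have key := le_mutualInfo hp0 hp1 g hg1 (I.filter (α · = a)) C ?_ hκ0 hd0 ?_ hCκ ?_ ?_
  · refine le_trans (le_of_eq ?_) key
    have : (Fintype.card A - 1 : ℝ) ≠ 0 := by linarith
    rw [eigMin, hκ, hd]
    field_simp
  · rw [Finset.disjoint_left]
    intro e he heC
    obtain ⟨b, hb⟩ := (Finset.mem_filter.1 (Finset.mem_filter.1 he).1).2
    have := (Finset.mem_filter.1 heC).2 b
    simp [hb] at this
  · simpa only [hcol] using ha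
  · rw [Finset.mul_sum]
    refine Finset.sum_le_sum fun e he => ?_
    obtain ⟨heI, rfl⟩ := Finset.mem_filter.1 he
    rw [hcol, hGe]
    exact (hα e (Finset.mem_filter.1 heI).2).2
  · refine Finset.sum_nonpos fun e he => ?_
    rw [hGe]
    refine setIntegral_nonpos (measurableSet_discRegret M ε π e) fun r hr => ?_
    have hr' : discRegret M ε r π = e := hr
    have : discRegret M ε r π s a = .correct := by rw [hr']; exact (Finset.mem_filter.1 he).2 a
    rw [sub_nonpos]
    exact expert_mono M hβ.le r s ((discRegret_eq_correct_iff M r π s a).1 this)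

end InformationGain

/-! ### The interaction process and Bayes' rule -/

section Run

/-- Restricting `μ` to `P` reduces this to summing over fibres of `f`; only those fibres have to be
measurable, so `P` can be arbitrary. -/
lemma sum_measureReal_and_eq {Ω X : Type*} [MeasurableSpace Ω] (μ : Measure Ω)
    [IsFiniteMeasure μ] (P : Ω → Prop) (f : Ω → X) (hf : ∀ x, MeasurableSet {ω | f ω = x})
    (T : Finset X) :
    ∑ x ∈ T, μ.real {ω | f ω = x ∧ P ω} = μ.real {ω | f ω ∈ T ∧ P ω} := by
  have h := sum_measureReal_preimage_singleton (μ := μ.restrict {ω | P ω}) (f := f) T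
    fun x _ => hf x
  have hT : MeasurableSet (f ⁻¹' (T : Set X)) := by
    have : f ⁻¹' (T : Set X) = ⋃ x ∈ T, {ω | f ω = x} := by
      ext ω
      simp
    rw [this]
    exact T.measurableSet_biUnion fun x _ => hf x
  rw [measureReal_restrict_apply hT] at h
  refine Eq.trans (Finset.sum_congr rfl fun x _ => ?_) h
  change _ = (μ.restrict {ω | P ω}).real {ω | f ω = x}
  rw [measureReal_restrict_apply (hf x)]
  rfl

variable {S A : Type*} {len : ℕ → ℕ} {Ω : Type*} {τ : (n : ℕ) → Ω → Traj S A (len n)}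

lemma dataAt_succ_eq_iff {n : ℕ} {ω : Ω} {D : Data S A len (n + 1)} :
    dataAt τ (n + 1) ω = D ↔
      dataAt τ n ω = (fun i : Fin n => D i.castSucc) ∧ τ n ω = D (Fin.last n) := by
  constructor
  · rintro rfl
    exact ⟨rfl, rfl⟩
  · rintro ⟨h1, h2⟩
    funext i
    refine Fin.lastCases ?_ (fun j => ?_) i
    · exact h2
    · exact congrFun h1 j

variable [Fintype S] [Fintype A]

lemma sum_data_succ [DecidableEq S] [DecidableEq A] {n : ℕ}
    (F : Data S A len n → Traj S A (len n) → ℝ) :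
    ∑ D : Data S A len (n + 1), F (fun i => D i.castSucc) (D (Fin.last n)) = ∑ D, ∑ t, F D t := by
  rw [← Fintype.sum_prod_type_right (f := fun x : Traj S A (len n) × Data S A len n => F x.2 x.1)]
  exact Fintype.sum_equiv (Fin.snocEquiv fun i : Fin (n + 1) => Traj S A (len i)).symm _ _
    fun D => rfl

lemma dataLik_succ (M : MDP S A) (β : ℝ) {n : ℕ} (D : Data S A len (n + 1)) (r : Reward S A) :
    dataLik M β D r = dataLik M β (len := len) (fun i : Fin n => D i.castSucc) r *
      trajLik M β r (D (Fin.last n)) :=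
  Fin.prod_univ_castSucc _

variable [DecidableEq S] {M : MDP S A} {β : ℝ} {prior : Measure (Reward S A)}
  {query : (n : ℕ) → Data S A len n → S} [MeasurableSpace Ω] {ℙ : Measure Ω}
  {R : Ω → Reward S A}

namespace IsRun

lemma measurableSet_dataAt (h : IsRun M β prior len query ℙ R τ) {n : ℕ} (D : Data S A len n) :
    MeasurableSet {ω | dataAt τ n ω = D} := by
  simp only [funext_iff (g := D), Set.ofPred_forall]
  exact .iInter fun i => h.measurable_demo i (D i)

lemma measurableSet_aggRegret (h : IsRun M β prior len query ℙ R τ) (ε : ℝ)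
    (e : (S → A) → S → A → Correctness) : MeasurableSet {ω | aggRegret M ε (R ω) = e} :=
  h.measurable_reward (PACEIG.measurableSet_aggRegret M ε e)

/-- The law of the next demonstration in terms of the joint law of reward and data. -/
lemma measure_demo_eq (h : IsRun M β prior len query ℙ R τ) {n : ℕ} (D : Data S A len n)
    (t : Traj S A (len n)) {B : Set (Reward S A)} (hB : MeasurableSet B) :
    ℙ {ω | R ω ∈ B ∧ dataAt τ n ω = D ∧ τ n ω = t} =
      ∫⁻ r in B, ENNReal.ofReal (demoProb M β r (query n D) t)
        ∂(ℙ.restrict {ω | dataAt τ n ω = D}).map R := by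
  rw [h.demo_law n D t B hB, setLIntegral_map hB
    (measurable_demoProb M β (query n D) t).ennreal_ofReal h.measurable_reward,
    Measure.restrict_restrict (h.measurable_reward hB)]
  rfl

/-- The joint law of the reward and the data is proportional to the likelihood. -/
lemma exists_map_restrict_eq (h : IsRun M β prior len query ℙ R τ) (n : ℕ)
    (D : Data S A len n) :
    ∃ c : ℝ≥0∞, (ℙ.restrict {ω | dataAt τ n ω = D}).map R =
      c • prior.withDensity fun r => ENNReal.ofReal (dataLik M β D r) := by
  induction n with
  | zero =>
    refine ⟨1, ?_⟩
    have h1 : {ω | dataAt τ 0 ω = D} = Set.univ :=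
      Set.eq_univ_of_forall fun ω => Subsingleton.elim _ _
    have h2 : (fun r => ENNReal.ofReal (dataLik M β D r)) = 1 := by
      funext r
      simp [dataLik]
    rw [h1, Measure.restrict_univ, h.map_reward, h2, withDensity_one, one_smul]
  | succ n ih =>
    set D' : Data S A len n := fun i => D i.castSucc with hD'
    set t : Traj S A (len n) := D (Fin.last n) with ht
    obtain ⟨c, hc⟩ := ih D'
    -- The query is a deterministic function of the data, so it contributes no likelihood factor:
    -- data with another initial state is impossible, and otherwise the constant is unchanged.
    refine ⟨if (t 0).1 = query n D' then c else 0, ?_⟩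
    ext B hB
    have hset : R ⁻¹' B ∩ {ω | dataAt τ (n + 1) ω = D} =
        {ω | R ω ∈ B ∧ dataAt τ n ω = D' ∧ τ n ω = t} := by
      ext ω
      simp only [Set.mem_inter_iff, Set.mem_preimage, Set.mem_ofPred_eq, dataAt_succ_eq_iff, hD',
        ht]
    have hmeas : Measurable fun r => ENNReal.ofReal (dataLik M β D' r) :=
      (measurable_dataLik M β D').ennreal_ofReal
    rw [Measure.map_apply h.measurable_reward hB,
      Measure.restrict_apply (h.measurable_reward hB), hset, h.measure_demo_eq D' t hB, hc,
      Measure.restrict_smul, lintegral_smul_measure,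
      setLIntegral_withDensity_eq_setLIntegral_mul _ hmeas
        (measurable_demoProb M β (query n D') t).ennreal_ofReal hB,
      Measure.smul_apply, withDensity_apply _ hB]
    split_ifs with hq
    · congr 1
      refine lintegral_congr fun r => ?_
      rw [dataLik_succ, Pi.mul_apply, ← ENNReal.ofReal_mul (dataLik_nonneg M β D' r), demoProb,
        if_pos hq]
    · simp [demoProb, hq]

/-- The posterior is the conditional law of the reward given the data. -/
lemma map_restrict_eq [IsProbabilityMeasure prior] (h : IsRun M β prior len query ℙ R τ) {n : ℕ}
    (D : Data S A len n) :
    (ℙ.restrict {ω | dataAt τ n ω = D}).map R =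
      ℙ {ω | dataAt τ n ω = D} • posterior M β prior D := by
  obtain ⟨c, hc⟩ := h.exists_map_restrict_eq n D
  have hD : ℙ {ω | dataAt τ n ω = D} =
      c * ∫⁻ r, ENNReal.ofReal (dataLik M β D r) ∂prior := by
    have := congrArg (fun μ => μ Set.univ) hc
    simpa [Measure.map_apply h.measurable_reward MeasurableSet.univ,
      withDensity_apply _ MeasurableSet.univ] using this
  rw [hc]
  -- Data of zero evidence has probability zero, and both sides are the zero measure; otherwise the
  -- evidence cancels against the normalization.
  by_cases hZ : ∫⁻ r, ENNReal.ofReal (dataLik M β D r) ∂prior = 0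
  · have : prior.withDensity (fun r => ENNReal.ofReal (dataLik M β D r)) = 0 := by
      rw [← Measure.measure_univ_eq_zero, withDensity_apply _ MeasurableSet.univ,
        Measure.restrict_univ, hZ]
    rw [posterior_eq_zero M β D prior hZ, this, smul_zero, smul_zero]
  · rw [hD, posterior, smul_smul, mul_assoc,
      ENNReal.mul_inv_cancel hZ (lintegral_dataLik_ne_top M β D prior), mul_one]

lemma measureReal_demo_eq [IsProbabilityMeasure prior]
    (h : IsRun M β prior len query ℙ R τ) {n : ℕ} (D : Data S A len n)
    (t : Traj S A (len n)) {B : Set (Reward S A)} (hB : MeasurableSet B) :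
    ℙ.real {ω | R ω ∈ B ∧ dataAt τ n ω = D ∧ τ n ω = t} =
      ℙ.real {ω | dataAt τ n ω = D} *
        ∫ r in B, demoProb M β r (query n D) t ∂posterior M β prior D := by
  rw [measureReal_def, h.measure_demo_eq D t hB, h.map_restrict_eq D, Measure.restrict_smul,
    lintegral_smul_measure, smul_eq_mul, ENNReal.toReal_mul, ← measureReal_def,
    integral_eq_lintegral_of_nonneg_ae
      (Filter.Eventually.of_forall fun r => demoProb_nonneg M β r _ t)
      (measurable_demoProb M β _ t).aestronglyMeasurable]

end IsRun

end Run

/-! ### The entropy budget and its expected decrease -/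

section Entropy

variable {S A : Type*} [Fintype S] [DecidableEq S] [Fintype A] {len : ℕ → ℕ}
  {Ω : Type*} [MeasurableSpace Ω]

/-- Joint probabilities of the data `D`, the next demonstration and `E`. -/
def jointProb (M : MDP S A) (ε : ℝ) (ℙ : Measure Ω) (R : Ω → Reward S A)
    (τ : (n : ℕ) → Ω → Traj S A (len n)) {n : ℕ} (D : Data S A len n) (t : Traj S A (len n))
    (e : (S → A) → S → A → Correctness) : ℝ :=
  ℙ.real {ω | aggRegret M ε (R ω) = e ∧ dataAt τ n ω = D ∧ τ n ω = t}

variable {M : MDP S A} {β : ℝ} {prior : Measure (Reward S A)}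
  {query : (n : ℕ) → Data S A len n → S} {ℙ : Measure Ω} [IsProbabilityMeasure ℙ]
  {R : Ω → Reward S A} {τ : (n : ℕ) → Ω → Traj S A (len n)}

lemma IsRun.sum_demo_jointProb (h : IsRun M β prior len query ℙ R τ) (ε : ℝ) {n : ℕ}
    (D : Data S A len n) (e : (S → A) → S → A → Correctness) :
    ∑ t, jointProb M ε ℙ R τ D t e =
      ℙ.real {ω | aggRegret M ε (R ω) = e ∧ dataAt τ n ω = D} := by
  have h1 := sum_measureReal_and_eq ℙ (fun ω => aggRegret M ε (R ω) = e ∧ dataAt τ n ω = D)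
    (τ n) (h.measurable_demo n) Finset.univ
  simp only [Finset.mem_univ, true_and] at h1
  rw [← h1]
  refine Finset.sum_congr rfl fun t _ => ?_
  rw [jointProb]
  congr 1
  ext ω
  simp only [Set.mem_ofPred_eq]
  tauto

variable [DecidableEq A]

/-- The entropy of `E` given the first `n` demonstrations. -/
def condEntropy (M : MDP S A) (ε : ℝ) (ℙ : Measure Ω) (R : Ω → Reward S A)
    (τ : (n : ℕ) → Ω → Traj S A (len n)) (n : ℕ) : ℝ :=
  ∑ D : Data S A len n,
    (∑ e, Real.negMulLog (ℙ.real {ω | aggRegret M ε (R ω) = e ∧ dataAt τ n ω = D}) -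
      Real.negMulLog (ℙ.real {ω | dataAt τ n ω = D}))

namespace IsRun

lemma sum_regret_jointProb (h : IsRun M β prior len query ℙ R τ) (ε : ℝ) {n : ℕ}
    (D : Data S A len n) (t : Traj S A (len n)) :
    ∑ e, jointProb M ε ℙ R τ D t e = ℙ.real {ω | dataAt τ n ω = D ∧ τ n ω = t} := by
  unfold jointProb
  rw [sum_measureReal_and_eq ℙ (fun ω => dataAt τ n ω = D ∧ τ n ω = t)
    (fun ω => aggRegret M ε (R ω)) (h.measurableSet_aggRegret ε)]
  simp

lemma sum_jointProb (h : IsRun M β prior len query ℙ R τ) (ε : ℝ) {n : ℕ}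
    (D : Data S A len n) :
    ∑ t, ∑ e, jointProb M ε ℙ R τ D t e = ℙ.real {ω | dataAt τ n ω = D} := by
  rw [Finset.sum_comm]
  simp only [h.sum_demo_jointProb ε D]
  rw [sum_measureReal_and_eq ℙ (fun ω => dataAt τ n ω = D)
    (fun ω => aggRegret M ε (R ω)) (h.measurableSet_aggRegret ε)]
  simp

/-- The chain rule: the decrease of the conditional entropy is the expected information gain. -/
lemma condEntropy_sub (h : IsRun M β prior len query ℙ R τ) (ε : ℝ) (n : ℕ) :
    condEntropy M ε ℙ R τ n - condEntropy M ε ℙ R τ (n + 1) =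
      ∑ D : Data S A len n, ℙ.real {ω | dataAt τ n ω = D} *
        mutualInfo (fun t e => jointProb M ε ℙ R τ D t e / ℙ.real {ω | dataAt τ n ω = D}) := by
  -- The data at time `n + 1` is the pair of old data and new demonstration, so the difference
  -- becomes, for each `D`, the entropy form of mutual information in `mul_mutualInfo_div`.
  have hsucc : condEntropy M ε ℙ R τ (n + 1) = ∑ D : Data S A len n, ∑ t,
      (∑ e, Real.negMulLog (jointProb M ε ℙ R τ D t e) -
        Real.negMulLog (∑ e, jointProb M ε ℙ R τ D t e)) := by
    rw [← sum_data_succ, condEntropy]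
    refine Finset.sum_congr rfl fun D _ => ?_
    simp only [dataAt_succ_eq_iff]
    rw [h.sum_regret_jointProb]
    rfl
  rw [hsucc, condEntropy, ← Finset.sum_sub_distrib]
  refine Finset.sum_congr rfl fun D _ => ?_
  rw [mul_mutualInfo_div (p := jointProb M ε ℙ R τ D) (fun t e => measureReal_nonneg)
    (h.sum_jointProb ε D)]
  simp only [h.sum_demo_jointProb]

lemma condEntropy_nonneg (h : IsRun M β prior len query ℙ R τ) (ε : ℝ) (n : ℕ) :
    0 ≤ condEntropy M ε ℙ R τ n := by
  refine Finset.sum_nonneg fun D _ => sub_nonneg.2 ?_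
  have h1 : ∑ e, ℙ.real {ω | aggRegret M ε (R ω) = e ∧ dataAt τ n ω = D} =
      ℙ.real {ω | dataAt τ n ω = D} := by
    rw [sum_measureReal_and_eq ℙ (fun ω => dataAt τ n ω = D)
      (fun ω => aggRegret M ε (R ω)) (h.measurableSet_aggRegret ε)]
    simp
  rw [← h1]
  exact negMulLog_sum_le fun e => measureReal_nonneg

lemma condEntropy_zero (h : IsRun M β prior len query ℙ R τ) (ε : ℝ) :
    condEntropy M ε ℙ R τ 0 = entropyE M ε prior := by
  have h0 : ∀ (D : Data S A len 0) (ω : Ω), (dataAt τ 0 ω = D) = True := fun D ω =>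
    eq_true (Subsingleton.elim _ _)
  have h1 : ∀ e, ℙ.real {ω | aggRegret M ε (R ω) = e} = prior.real {r | aggRegret M ε r = e} :=
    fun e => by
      rw [← h.map_reward, map_measureReal_apply h.measurable_reward
        (PACEIG.measurableSet_aggRegret M ε e)]
      rfl
  simp only [condEntropy, h0, and_true, h1, entropyE]
  simp

variable [IsProbabilityMeasure prior]

/-- The information gain about `E` is at least the value of the acquisition function. -/
lemma acquisition_le (h : IsRun M β prior len query ℙ R τ) (ε : ℝ) {n : ℕ}
    (D : Data S A len n) (π : S → A) (hD : ℙ.real {ω | dataAt τ n ω = D} ≠ 0) :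
    acquisition M β ε prior D π (query n D) ≤
      mutualInfo (fun t e => jointProb M ε ℙ R τ D t e / ℙ.real {ω | dataAt τ n ω = D}) := by
  -- Evaluation at `π` maps `E` to `E^π`; the fibre sums of the joint law are, by Bayes' rule, the
  -- posterior integrals in the acquisition function.
  refine le_trans (le_of_eq ?_) (mutualInfo_fiber_le (fun e => e π)
    fun t e => div_nonneg measureReal_nonneg measureReal_nonneg)
  rw [acquisition]
  congr 1
  funext t e
  rw [← Finset.sum_div, eq_div_iff hD, mul_comm,
    ← h.measureReal_demo_eq D t (measurableSet_discRegret M ε π e)]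
  unfold jointProb
  rw [sum_measureReal_and_eq ℙ (fun ω => dataAt τ n ω = D ∧ τ n ω = t)
    (fun ω => aggRegret M ε (R ω)) (h.measurableSet_aggRegret ε)]
  simp [aggRegret]

/-- Argue separately for each value of the data. Where PAC holds, information is nonnegative; where
it fails, some state offers at least `eigMin` and the chosen query does no worse. The bound holds at
every `n`, also after PAC has first been reached. -/
lemma eigMin_mul_le [Nonempty A] {apprentice : (n : ℕ) → Data S A len n → S → A} {ε δ : ℝ}
    (h : IsRun M β prior len query ℙ R τ)
    (h_alg : IsPACEIG M β ε prior len apprentice query) (hβ : 0 < β) (hε : 0 < ε) (hδ : 0 < δ)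
    (hδ' : δ ≤ 1 / 2) (hA : 2 ≤ Fintype.card A) (n : ℕ) :
    eigMin M β ε δ * ℙ.real {ω | ¬ PACReached M β ε δ prior (dataAt τ n ω)} ≤
      condEntropy M ε ℙ R τ n - condEntropy M ε ℙ R τ (n + 1) := by
  classical
  have hsum : ℙ.real {ω | ¬ PACReached M β ε δ prior (dataAt τ n ω)} =
      ∑ D : Data S A len n with ¬ PACReached M β ε δ prior D,
        ℙ.real {ω | dataAt τ n ω = D} := by
    have := sum_measureReal_and_eq ℙ (fun _ => True) (dataAt τ n)
      (fun D => h.measurableSet_dataAt D)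
      (Finset.univ.filter fun D => ¬ PACReached M β ε δ prior D)
    simpa using this.symm
  rw [hsum, h.condEntropy_sub, Finset.sum_filter, Finset.mul_sum]
  refine Finset.sum_le_sum fun D _ => ?_
  rcases eq_or_ne (ℙ.real {ω | dataAt τ n ω = D}) 0 with hD | hD
  · simp [hD]
  · split_ifs with hPAC
    · rw [mul_zero]
      refine mul_nonneg measureReal_nonneg (mutualInfo_nonneg
        (fun t e => div_nonneg measureReal_nonneg measureReal_nonneg) ?_)
      simp only [← Finset.sum_div]
      rw [h.sum_jointProb ε D, div_self hD]
    · rw [mul_comm]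
      refine mul_le_mul_of_nonneg_left ?_ measureReal_nonneg
      refine le_trans ?_ (h.acquisition_le ε D (apprentice n D) hD)
      have hreg : ∀ π : S → A,
          ENNReal.ofReal δ < posterior M β prior D {r | ε ≤ regret M r π} := by
        simpa [PACReached] using hPAC
      -- With zero evidence the posterior would be the zero measure, which satisfies PAC trivially;
      -- hence failure of PAC guarantees a genuine probability measure.
      have hZ : ∫⁻ r, ENNReal.ofReal (dataLik M β D r) ∂prior ≠ 0 := fun hZ => by
        have := hreg (apprentice n D)
        rw [posterior_eq_zero M β D prior hZ] at this
        simp at this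
      have := isProbabilityMeasure_posterior M β D prior hZ
      obtain ⟨s, hs⟩ := exists_eigMin_le_mutualInfo M hβ hε hδ hδ' hA (posterior M β prior D)
        (apprentice n D) (h_alg.apprentice_max n D) (hreg _) (len n)
      exact hs.trans (h_alg.query_max n D s)

end IsRun

end Entropy

/-! ### From failure probabilities to the stopping time -/

section StoppingTime

variable {S A : Type*} [Fintype S] [Fintype A] (M : MDP S A)

lemma eigMin_pos {β ε δ : ℝ} (hβ : 0 < β) (hε : 0 < ε) (hδ : 0 < δ)
    (hA : 2 ≤ Fintype.card A) : 0 < eigMin M β ε δ := by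
  have hA' : (2 : ℝ) ≤ Fintype.card A := by exact_mod_cast hA
  have : Nonempty S := nonempty_state M
  have hS : (0 : ℝ) < Fintype.card S := by exact_mod_cast Fintype.card_pos
  have hx : 0 < β * (1 - M.disc) * ε := mul_pos (mul_pos hβ (sub_pos.2 M.disc_lt_one)) hε
  have hexp : 0 < 1 - Real.exp (-(β * (1 - M.disc) * ε)) := by
    rw [sub_pos, Real.exp_lt_one_iff]; linarith
  have hA1 : (0 : ℝ) < Fintype.card A - 1 := by linarith
  unfold eigMin
  positivity

/-- PAC fails at each of the `N` times `0, …, N - 1` before it first holds. It may fail again later,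
hence only an inequality; if it never holds, the sum is infinite. -/
lemma stepsToPAC_le_tsum [DecidableEq S] [DecidableEq A] (β ε δ : ℝ)
    (prior : Measure (Reward S A)) {len : ℕ → ℕ} {Ω : Type*}
    (τ : (n : ℕ) → Ω → Traj S A (len n)) (ω : Ω) :
    stepsToPAC M β ε δ prior τ ω ≤
      ∑' n, {ω | ¬ PACReached M β ε δ prior (dataAt τ n ω)}.indicator 1 ω := by
  classical
  by_cases h : ∃ n, PACReached M β ε δ prior (dataAt τ n ω)
  · refine (iInf₂_le (Nat.find h) (Nat.find_spec h)).trans ?_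
    calc (Nat.find h : ℝ≥0∞) = ∑ n ∈ Finset.range (Nat.find h),
          {ω | ¬ PACReached M β ε δ prior (dataAt τ n ω)}.indicator 1 ω := by
          rw [Finset.sum_congr rfl fun n hn => Set.indicator_of_mem
            (show ω ∈ {ω | ¬ PACReached M β ε δ prior (dataAt τ n ω)} from
              Nat.find_min h (Finset.mem_range.1 hn)) 1]
          simp
      _ ≤ _ := ENNReal.sum_le_tsum _
  · push Not at h
    have : ∀ n, {ω | ¬ PACReached M β ε δ prior (dataAt τ n ω)}.indicator
        (1 : Ω → ℝ≥0∞) ω = 1 := fun n => Set.indicator_of_mem (h n) 1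
    simp [this]

end StoppingTime

/-- With a single action, the only policy is optimal. -/
lemma pacReached_of_card_le_one {S A : Type*} [Fintype S] [Fintype A] [Nonempty A] (M : MDP S A)
    {β ε δ : ℝ} (hε : 0 < ε) (prior : Measure (Reward S A)) {len : ℕ → ℕ} {n : ℕ}
    (D : Data S A len n) (hA : Fintype.card A ≤ 1) : PACReached M β ε δ prior D := by
  have : Subsingleton A := Fintype.card_le_one_iff_subsingleton.1 hA
  refine ⟨fun _ => Classical.arbitrary A, ?_⟩
  have hempty : {r : Reward S A | ε ≤ regret M r fun _ => Classical.arbitrary A} = ∅ := by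
    refine Set.eq_empty_of_forall_notMem fun r hr => ?_
    obtain ⟨s, hs⟩ := exists_of_le_regret M r _ hr
    obtain ⟨a, ha⟩ := exists_optQ_eq M r s
    rw [← ha, Subsingleton.elim a (Classical.arbitrary A), sub_self] at hs
    exact absurd hs (mul_pos hε (sub_pos.2 M.disc_lt_one)).not_ge
  rw [hempty, measure_empty]
  exact zero_le

end PACEIG

end

theorem mainTheorem2 {S A : Type*} [Fintype S] [DecidableEq S] [Fintype A] [DecidableEq A]
    [Nonempty A] (M : PACEIG.MDP S A) (β ε δ : ℝ) (hβ : 0 < β) (hε : 0 < ε) (hδ : 0 < δ)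
    (hδ' : δ ≤ 1 / 2)
    (prior : MeasureTheory.Measure (PACEIG.Reward S A))
    [MeasureTheory.IsProbabilityMeasure prior]
    (hmax : ℝ) (h_entropy : PACEIG.entropyE M ε prior ≤ hmax)
    (len : ℕ → ℕ)
    (apprentice : (n : ℕ) → PACEIG.Data S A len n → S → A)
    (query : (n : ℕ) → PACEIG.Data S A len n → S)
    (h_alg : PACEIG.IsPACEIG M β ε prior len apprentice query)
    {Ω : Type*} [MeasurableSpace Ω] (ℙ : MeasureTheory.Measure Ω)
    [MeasureTheory.IsProbabilityMeasure ℙ]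
    (R : Ω → PACEIG.Reward S A) (τ : (n : ℕ) → Ω → PACEIG.Traj S A (len n))
    (h_run : PACEIG.IsRun M β prior len query ℙ R τ) :
    ∫⁻ ω, PACEIG.stepsToPAC M β ε δ prior τ ω ∂ℙ ≤
        ENNReal.ofReal (hmax / PACEIG.eigMin M β ε δ) ∧
      hmax / PACEIG.eigMin M β ε δ =
        4 * hmax * (Fintype.card A : ℝ) ^ 2 * ((Fintype.card A : ℝ) - 1) ^ 3 *
            (Fintype.card S : ℝ) /
          (δ * (1 - Real.exp (-(β * (1 - M.disc) * ε))) ^ 2) := by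
  classical
  refine ⟨?_, ?_⟩
  · rcases Nat.lt_or_ge (Fintype.card A) 2 with hA | hA
    · have h0 : ∀ ω, PACEIG.stepsToPAC M β ε δ prior τ ω = 0 := fun ω => by
        refine le_antisymm ?_ zero_le
        rw [← Nat.cast_zero]
        exact iInf₂_le (f := fun (n : ℕ) _ => (n : ENNReal)) 0
          (PACEIG.pacReached_of_card_le_one M hε prior _ (by omega))
      simp [h0]
    · set c := PACEIG.eigMin M β ε δ with hc
      have hc0 : 0 < c := PACEIG.eigMin_pos M hβ hε hδ hA
      set U : ℕ → Set Ω := fun n => {ω | ¬ PACEIG.PACReached M β ε δ prior (PACEIG.dataAt τ n ω)}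
        with hU
      have hUm : ∀ n, MeasurableSet (U n) := fun n => by
        have : U n = ⋃ D ∈ {D : PACEIG.Data S A len n | ¬ PACEIG.PACReached M β ε δ prior D},
            {ω | PACEIG.dataAt τ n ω = D} := by
          ext ω
          simp [hU]
        rw [this]
        exact .biUnion (Set.to_countable _) fun D _ => h_run.measurableSet_dataAt D
      have hpartial : ∀ K : ℕ, ∑ n ∈ Finset.range K, ℙ.real (U n) ≤ hmax / c := fun K => by
        rw [le_div_iff₀ hc0, mul_comm, Finset.mul_sum]
        calc ∑ n ∈ Finset.range K, c * ℙ.real (U n)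
            ≤ ∑ n ∈ Finset.range K, (PACEIG.condEntropy M ε ℙ R τ n -
                PACEIG.condEntropy M ε ℙ R τ (n + 1)) :=
              Finset.sum_le_sum fun n _ => h_run.eigMin_mul_le h_alg hβ hε hδ hδ' hA n
          _ = PACEIG.condEntropy M ε ℙ R τ 0 - PACEIG.condEntropy M ε ℙ R τ K :=
              Finset.sum_range_sub' _ K
          _ ≤ hmax := by
              rw [h_run.condEntropy_zero ε]
              linarith [h_run.condEntropy_nonneg ε K]
      calc ∫⁻ ω, PACEIG.stepsToPAC M β ε δ prior τ ω ∂ℙ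
          ≤ ∫⁻ ω, ∑' n, (U n).indicator 1 ω ∂ℙ :=
            MeasureTheory.lintegral_mono fun ω =>
              PACEIG.stepsToPAC_le_tsum M β ε δ prior τ ω
        _ = ∑' n, ℙ (U n) := by
            rw [MeasureTheory.lintegral_tsum fun n =>
              (measurable_one.indicator (hUm n)).aemeasurable]
            simp only [MeasureTheory.lintegral_indicator_one (hUm _)]
        _ ≤ ENNReal.ofReal (hmax / c) := ENNReal.tsum_le_of_sum_range_le fun K => by
            rw [Finset.sum_congr rfl fun n _ => (MeasureTheory.ofReal_measureReal (μ := ℙ)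
              (s := U n)).symm, ← ENNReal.ofReal_sum_of_nonneg fun n _ => MeasureTheory.measureReal_nonneg]
            exact ENNReal.ofReal_le_ofReal (hpartial K)
  -- No case split on `|A|` is needed: for `|A| = 1` the factor `|A| - 1` vanishes, and division by
  -- zero makes both sides `0`.
  · rw [PACEIG.eigMin, div_div_eq_mul_div]
    ring
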